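/- Let $p$ be a prime, let $k$ be an algebraically closed field of characteristic $p$, and let $\mathcal{O}$ be a complete discrete valuation ring of characteristic $0$ with residue field $k$. Let $R$ be either $\mathcal{O}$ or $k$, let $G$ and $H$ be finite groups, and let $A = RGe$ and $B = RHf$ be blocks of $RG$ and $RH$, where $e$ and $f$ are primitive idempotents of the centres $Z(RG)$ and $Z(RH)$. All modules are finitely generated. An $(A,B)$-bimodule $M$ is regarded as an $R[G\times H]$-module via $(g,h)m = gmh^{-1}$, and $M^* = \operatorname{Hom}_R(M,R)$ denotes its $R$-dual, a $(B,A)$-bimodule. It is a $p$-permutation bimodule if its restriction to every $p$-subgroup of $G\times H$ has a finite $R$-basis permuted by that subgroup. A twisted diagonal subgroup of $G\times H$ is a subgroup of the form $\{(\phi(q),q) \mid q\in Q\}$ for an isomorphism $\phi : Q\to P$ between subgroups $Q\le H$ and $P\le G$. A splendid Rickard complex for $A$ and $B$ (also called a splendid Rickard equivalence) is a bounded chain complex $C$ of $p$-permutation $(A,B)$-bimodules such that every indecomposable direct summand of every term $C_n$ has a twisted diagonal subgroup of $G\times H$ as a vertex, and such that $C\otimes_B C^*\simeq A$ in $K^b({}_A\mathbf{mod}_A)$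 and $C^*\otimes_A C\simeq B$ in $K^b({}_B\mathbf{mod}_B)$, with $A$ and $B$ placed in degree $0$. Here $K^b$ denotes the bounded homotopy category. **Proposition.** Let $C$ be a splendid Rickard complex for the blocks $A$ and $B$. Then $C$ is an indecomposable object of $K^b({}_A\mathbf{mod}_B)$. Moreover, as a chain complex of $(A,B)$-bimodules, $C$ has an indecomposable noncontractible direct summand $D$; it is unique up to isomorphism of chain complexes, and $D$ is itself a splendid Rickard complex for $A$ and $B$. -/

import Mathlib

open CategoryTheory CategoryTheory.Limits
open scoped TensorProduct MonoidAlgebra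

universe u

/-- The usual Koszul signs `(-1)^n` for tensor products of `ℤ`-graded chain complexes: the
differential on `Cᵢ ⊗ Dⱼ` is `d ⊗ 1 + (-1)^i (1 ⊗ d)`. -/
instance instTensorSignsDownInt : (ComplexShape.down ℤ).TensorSigns where
  ε' := MonoidHom.mk' Int.negOnePow Int.negOnePow_add
  rel_add p q r hpq := by
    change q + 1 = p at hpq
    change q + r + 1 = p + r
    lia
  add_rel p q r hpq := by
    change q + 1 = p at hpq
    change r + q + 1 = r + p
    lia
  ε'_succ p q hpq := by
    change q + 1 = p at hpq
    subst hpq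
    change q.negOnePow = -(q + 1).negOnePow
    rw [Int.negOnePow_succ, neg_neg]

noncomputable section

namespace Splendid

/-! ### Direct summands, contractible complexes -/

/-- `X` is (isomorphic to) a direct summand of `Y`. -/
def IsDirectSummand {𝓒 : Type*} [Category 𝓒] [HasZeroMorphisms 𝓒] [HasBinaryBiproducts 𝓒]
    (X Y : 𝓒) : Prop :=
  ∃ Z : 𝓒, Nonempty (Y ≅ X ⊞ Z)

/-- A chain complex is contractible if its identity map is null-homotopic. -/
def Contractible {𝓒 : Type*} [Category 𝓒] [Preadditive 𝓒] (C : ChainComplex 𝓒 ℤ) : Prop :=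
  Nonempty (Homotopy (𝟙 C) 0)

/-! ### Permutation modules and vertices

For a finite group `Γ`, an `RΓ`-module is an object of `Rep R Γ`. -/

section Modules

variable {R : Type u} [CommRing R] {Γ : Type u} [Group Γ]

/-- A (finitely generated) permutation module: it has a finite `R`-basis permuted by `Γ`. -/
def IsPermutationModule (M : Rep.{u} R Γ) : Prop :=
  ∃ (X : Type u) (_ : Finite X) (_ : MulAction Γ X), Nonempty (M ≅ Rep.ofMulAction R Γ X)

/-- A `p`-permutation module: its restriction to each `p`-subgroup is a permutation module. -/
def IsPPermutationModule (p : ℕ) (M : Rep.{u} R Γ) : Prop :=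
  ∀ P : Subgroup Γ, IsPGroup p P → IsPermutationModule (Rep.res P.subtype M)

/-- `M` is relatively `Q`-projective: it is a direct summand of `Ind_Q^Γ V` for some finitely
generated `RQ`-module `V`. -/
def IsRelativelyProjective (Q : Subgroup Γ) (M : Rep.{u} R Γ) : Prop :=
  ∃ V : Rep.{u} R Q, Module.Finite R V ∧ IsDirectSummand M (Rep.ind Q.subtype V)

/-- `Q` is a vertex of the (indecomposable) module `M`: it is minimal among the subgroups relative
to which `M` is projective. -/
def IsVertex (Q : Subgroup Γ) (M : Rep.{u} R Γ) : Prop :=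
  Minimal (fun Q' : Subgroup Γ => IsRelativelyProjective Q' M) Q

end Modules

/-- `X ≤ G × H` is twisted diagonal: `X = {(φ q, q) | q ∈ Q}` for an isomorphism `φ : Q ≃ P`
between subgroups `Q ≤ H` and `P ≤ G`. -/
def IsTwistedDiagonal {G H : Type u} [Group G] [Group H] (X : Subgroup (G × H)) : Prop :=
  ∃ (P : Subgroup G) (Q : Subgroup H) (φ : Q ≃* P),
    (X : Set (G × H)) = {x | ∃ q : Q, x = ((φ q : G), (q : H))}

/-! ### Blocks -/

/-- A sum of blocks of `RG`, i.e. the algebra `RG e` for a central idempotent `e` of `RG`;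
it is recorded by the idempotent `e`. -/
structure BlockSum (R G : Type u) [CommRing R] [Group G] where
  /-- the identity element of the algebra -/
  idem : R[G]
  isIdempotentElem : IsIdempotentElem idem
  central : idem ∈ Set.center R[G]

namespace BlockSum

variable {R G : Type u} [CommRing R] [Group G]

/-- The sum of blocks `RG e` is a block if `e` is primitive as an idempotent of the centre of
`RG`. -/
def IsBlock (A : BlockSum R G) : Prop :=
  A.idem ≠ 0 ∧ ∀ i : R[G], IsIdempotentElem i → i ∈ Set.center R[G] →
    i * A.idem = i → i = 0 ∨ i = A.idem

/-- The `R`-submodule `RG e = e RG` of `RG`. -/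
def toSubmodule (A : BlockSum R G) : Submodule R R[G] :=
  LinearMap.range (LinearMap.mulLeft R A.idem)

lemma mul_idem_mul_mem (A : BlockSum R G) (a b x : R[G]) (hx : x ∈ A.toSubmodule) :
    a * x * b ∈ A.toSubmodule := by
  obtain ⟨y, rfl⟩ := hx
  refine ⟨a * y * b, ?_⟩
  have h := (Set.mem_center_iff.1 A.central).comm a
  simp only [LinearMap.mulLeft_apply]
  rw [← mul_assoc a, ← h.eq, mul_assoc, mul_assoc, mul_assoc]

/-- `A = RG e` as an `(A, A)`-bimodule, i.e. as an `R[G × G]`-module via `(g, h) a = g a h⁻¹`. -/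
def bimodule (A : BlockSum R G) : Rep.{u} R (G × G) :=
  Rep.of (X := A.toSubmodule)
    { toFun := fun x =>
        ((LinearMap.mulRight R (MonoidAlgebra.of R G x.2⁻¹)).comp
          (LinearMap.mulLeft R (MonoidAlgebra.of R G x.1))).restrict
            (fun a ha => A.mul_idem_mul_mem _ _ a ha)
      map_one' := by
        ext a : 2
        simp [LinearMap.restrict_apply, ← MonoidAlgebra.one_def]
      map_mul' := fun x y => by
        ext a : 2
        change MonoidAlgebra.of R G (x * y).1 * (a : R[G]) * MonoidAlgebra.of R G (x * y).2⁻¹ =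
          MonoidAlgebra.of R G x.1 *
            (MonoidAlgebra.of R G y.1 * (a : R[G]) * MonoidAlgebra.of R G y.2⁻¹) *
            MonoidAlgebra.of R G x.2⁻¹
        simp only [Prod.fst_mul, Prod.snd_mul, mul_inv_rev, map_mul, mul_assoc] }

end BlockSum

/-! ### Bimodules

An `(RG, RH)`-bimodule (with the same action of `R` on both sides) is an `R[G × H]`-module via
`(g, h) m = g m h⁻¹`. -/

section Bimodules

variable {R : Type u} [CommRing R] {G H K : Type u} [Group G] [Group H] [Group K]

/-- The action `m ↦ a m` of `a ∈ RG` on an `(RG, RH)`-bimodule. -/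
def leftAct (M : Rep.{u} R (G × H)) (a : R[G]) : Module.End R M :=
  Representation.asAlgebraHom (M.ρ.comp (MonoidHom.inl G H)) a

/-- The action `m ↦ m b` of `b ∈ RH` on an `(RG, RH)`-bimodule: if `b = ∑ r_h h`, then
`m b = ∑ r_h (m h) = ∑ r_h (1, h⁻¹) m`. -/
def rightAct (M : Rep.{u} R (G × H)) (b : R[H]) : Module.End R M :=
  Representation.asAlgebraHom (M.ρ.comp (MonoidHom.inr G H))
    (MonoidAlgebra.mapDomain (fun h => h⁻¹) b)

lemma asAlgebraHom_comm {Γ V W : Type*} [Group Γ] [AddCommGroup V] [Module R V] [AddCommGroup W]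
    [Module R W] (ρ : Representation R Γ V) (σ : Representation R Γ W) (f : V →ₗ[R] W)
    (h : ∀ g v, f (ρ g v) = σ g (f v)) (a : R[Γ]) (v : V) :
    f (ρ.asAlgebraHom a v) = σ.asAlgebraHom a (f v) := by
  induction a using MonoidAlgebra.induction_linear with
  | zero => simp
  | add x y hx hy => simp [hx, hy]
  | single g r => simp [h]

lemma hom_leftAct {M N : Rep.{u} R (G × H)} (f : M ⟶ N) (a : R[G]) (m : M) :
    f.hom (leftAct M a m) = leftAct N a (f.hom m) :=
  asAlgebraHom_comm (M.ρ.comp (MonoidHom.inl G H)) (N.ρ.comp (MonoidHom.inl G H))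
    f.hom.toLinearMap (fun _ _ => Rep.hom_comm_apply f _ _) a m

lemma hom_rightAct {M N : Rep.{u} R (G × H)} (f : M ⟶ N) (b : R[H]) (m : M) :
    f.hom (rightAct M b m) = rightAct N b (f.hom m) :=
  asAlgebraHom_comm (M.ρ.comp (MonoidHom.inr G H)) (N.ρ.comp (MonoidHom.inr G H))
    f.hom.toLinearMap (fun _ _ => Rep.hom_comm_apply f _ _) _ m

/-- A finitely generated `(A, B)`-bimodule for `A = RG e` and `B = RH f`: a finitely generated
`(RG, RH)`-bimodule `M` on which `e` and `f` act as the identity. -/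
structure IsBimodule (A : BlockSum R G) (B : BlockSum R H) (M : Rep.{u} R (G × H)) : Prop where
  finite : Module.Finite R M
  left : leftAct M A.idem = 1
  right : rightAct M B.idem = 1

/-- The `R`-module underlying `M ⊗_{RH} N`: the quotient of `M ⊗_R N` by the relations
`m h ⊗ n = m ⊗ h n`, that is, the coinvariants of `H` acting by `h (m ⊗ n) = m h⁻¹ ⊗ h n`. -/
abbrev balancedRep (M : Rep.{u} R (G × H)) (N : Rep.{u} R (H × K)) :
    Representation R H (M ⊗[R] N) :=
  Representation.tprod (M.ρ.comp (MonoidHom.inr G H)) (N.ρ.comp (MonoidHom.inl H K))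

lemma balancedRep_comm (M : Rep.{u} R (G × H)) (N : Rep.{u} R (H × K)) (x : G × K) (h : H) :
    TensorProduct.map (M.ρ (x.1, 1)) (N.ρ (1, x.2)) ∘ₗ balancedRep M N h =
      balancedRep M N h ∘ₗ TensorProduct.map (M.ρ (x.1, 1)) (N.ρ (1, x.2)) := by
  ext m n
  simp [← Module.End.mul_apply, ← map_mul]

/-- The tensor product `M ⊗_{RH} N` of bimodules, an `(RG, RK)`-bimodule via
`g (m ⊗ n) k = g m ⊗ n k`. If `M = M f` and `N = f N`, then it is the tensor product over `RH f`. -/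
def tensorObj (M : Rep.{u} R (G × H)) (N : Rep.{u} R (H × K)) : Rep.{u} R (G × K) :=
  Rep.of (X := (balancedRep M N).Coinvariants)
    { toFun := fun x => Representation.Coinvariants.map _ _
        ⟨TensorProduct.map (M.ρ (x.1, 1)) (N.ρ (1, x.2)), balancedRep_comm M N x⟩
      map_one' := by
        ext m n
        simp [← Prod.one_eq_mk]
      map_mul' := fun x y => by
        ext m n
        have h1 : ((x.1 * y.1, 1) : G × H) = (x.1, 1) * (y.1, 1) := by simp
        have h2 : ((1, x.2 * y.2) : H × K) = (1, x.2) * (1, y.2) := by simp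
        simp only [Prod.fst_mul, Prod.snd_mul, h1, h2, map_mul]
        rfl }

/-- Functoriality of the tensor product of bimodules. -/
def tensorMap {M M' : Rep.{u} R (G × H)} {N N' : Rep.{u} R (H × K)} (f : M ⟶ M') (g : N ⟶ N') :
    tensorObj M N ⟶ tensorObj M' N' :=
  Rep.ofHom
    ⟨Representation.Coinvariants.map _ _
      ⟨TensorProduct.map f.hom.toLinearMap g.hom.toLinearMap, fun h => by
        ext m n
        simp [Rep.hom_comm_apply]⟩, fun x => by
        ext m n
        simp [Rep.hom_comm_apply]⟩

lemma tensorObj_hom_ext {M : Rep.{u} R (G × H)} {N : Rep.{u} R (H × K)} {L : Rep.{u} R (G × K)}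
    {f g : tensorObj M N ⟶ L}
    (h : ∀ (m : M) (n : N),
      f.hom (Representation.Coinvariants.mk (balancedRep M N) (m ⊗ₜ[R] n)) =
        g.hom (Representation.Coinvariants.mk (balancedRep M N) (m ⊗ₜ[R] n))) : f = g := by
  apply Rep.hom_ext
  apply Representation.IntertwiningMap.toLinearMap_injective
  apply Representation.Coinvariants.hom_ext
  apply TensorProduct.ext'
  exact h

lemma tensorMap_mk {M M' : Rep.{u} R (G × H)} {N N' : Rep.{u} R (H × K)} (f : M ⟶ M')
    (g : N ⟶ N') (m : M) (n : N) :
    (tensorMap f g).hom (Representation.Coinvariants.mk (balancedRep M N) (m ⊗ₜ[R] n)) =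
      Representation.Coinvariants.mk (balancedRep M' N') (f.hom m ⊗ₜ[R] g.hom n) := rfl

variable (R G H K) in
/-- The tensor product of bimodules as a bifunctor. -/
def tensorFunctor : Rep.{u} R (G × H) ⥤ Rep.{u} R (H × K) ⥤ Rep.{u} R (G × K) where
  obj M :=
    { obj := fun N => tensorObj M N
      map := fun g => tensorMap (𝟙 M) g
      map_id := fun _ => tensorObj_hom_ext fun _ _ => rfl
      map_comp := fun _ _ => tensorObj_hom_ext fun _ _ => rfl }
  map f :=
    { app := fun N => tensorMap f (𝟙 N)
      naturality := fun _ _ _ => tensorObj_hom_ext fun _ _ => rfl }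
  map_id _ := by
    ext N : 2
    exact tensorObj_hom_ext fun _ _ => rfl
  map_comp _ _ := by
    ext N : 2
    exact tensorObj_hom_ext fun _ _ => rfl

instance tensorFunctor_additive : (tensorFunctor R G H K).Additive where
  map_add {M M'} f g := by
    ext N : 2
    refine tensorObj_hom_ext fun m n => ?_
    change Representation.Coinvariants.mk (balancedRep M' N) ((f.hom m + g.hom m) ⊗ₜ[R] n) =
      Representation.Coinvariants.mk (balancedRep M' N) (f.hom m ⊗ₜ[R] n) +
        Representation.Coinvariants.mk (balancedRep M' N) (g.hom m ⊗ₜ[R] n)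
    rw [TensorProduct.add_tmul, map_add]

instance tensorFunctor_obj_additive (M : Rep.{u} R (G × H)) :
    ((tensorFunctor R G H K).obj M).Additive where
  map_add {N N'} f g := by
    refine tensorObj_hom_ext fun m n => ?_
    change Representation.Coinvariants.mk (balancedRep M N') (m ⊗ₜ[R] (f.hom n + g.hom n)) =
      Representation.Coinvariants.mk (balancedRep M N') (m ⊗ₜ[R] f.hom n) +
        Representation.Coinvariants.mk (balancedRep M N') (m ⊗ₜ[R] g.hom n)
    rw [TensorProduct.tmul_add, map_add]

/-- The `R`-dual `M^* = Hom_R(M, R)` of an `(RG, RH)`-bimodule: the `(RH, RG)`-bimodule with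
`(h α g) m = α (g m h)`, i.e. `(h, g)` acts as `α ↦ α ∘ (g, h)⁻¹`. -/
def dualObj (M : Rep.{u} R (G × H)) : Rep.{u} R (H × G) :=
  Rep.of (M.ρ.dual.comp (MulEquiv.prodComm : H × G ≃* G × H).toMonoidHom)

/-- The dual (transpose) of a bimodule homomorphism. -/
def dualMap {M N : Rep.{u} R (G × H)} (f : M ⟶ N) : dualObj N ⟶ dualObj M :=
  Rep.ofHom
    ⟨Module.Dual.transpose (R := R) f.hom.toLinearMap, fun x => by
      ext α m
      change α (N.ρ (x.2, x.1)⁻¹ (f.hom m)) = α (f.hom (M.ρ (x.2, x.1)⁻¹ m))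
      rw [Rep.hom_comm_apply]⟩

lemma dualMap_zero {M N : Rep.{u} R (G × H)} : dualMap (0 : M ⟶ N) = 0 := by
  apply Rep.hom_ext
  ext α
  exact LinearMap.ext fun m => map_zero (show Module.Dual R N from α)

lemma dualMap_comp {M N L : Rep.{u} R (G × H)} (f : M ⟶ N) (g : N ⟶ L) :
    dualMap (f ≫ g) = dualMap g ≫ dualMap f := rfl

end Bimodules

/-! ### Complexes of bimodules -/

section Complexes

variable {R : Type u} [CommRing R] {G H K : Type u} [Group G] [Group H] [Group K]

/-- The tensor product `C ⊗_{RH} D` of chain complexes of bimodules: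
`(C ⊗ D)_n = ⨁_{i + j = n} Cᵢ ⊗ Dⱼ` with differential `d ⊗ 1 + (-1)^i (1 ⊗ d)`. -/
def tensorComplex (C : ChainComplex (Rep.{u} R (G × H)) ℤ) (D : ChainComplex (Rep.{u} R (H × K)) ℤ) :
    ChainComplex (Rep.{u} R (G × K)) ℤ :=
  HomologicalComplex.mapBifunctor C D (tensorFunctor R G H K) (ComplexShape.down ℤ)

/-- The `R`-dual `C^* = Hom_R(C, R)` of a chain complex of bimodules: `(C^*)_n = (C_{-n})^*`, and
the differential sends `α` of degree `n` to `(-1)^(n+1) α ∘ d`. -/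
def dualComplex (C : ChainComplex (Rep.{u} R (G × H)) ℤ) : ChainComplex (Rep.{u} R (H × G)) ℤ where
  X n := dualObj (C.X (-n))
  d i j := (i + 1).negOnePow • dualMap (C.d (-j) (-i))
  shape i j hij := by
    have h : ¬ (ComplexShape.down ℤ).Rel (-j) (-i) := by
      intro h
      apply hij
      change -i + 1 = -j at h
      change j + 1 = i
      lia
    rw [C.shape _ _ h, dualMap_zero, smul_zero]
  d_comp_d' i j k _ _ := by
    rw [Linear.units_smul_comp, Linear.comp_units_smul, ← dualMap_comp, C.d_comp_d, dualMap_zero,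
      smul_zero, smul_zero]

/-- A bounded chain complex of finitely generated `(A, B)`-bimodules. -/
structure IsBimoduleComplex (A : BlockSum R G) (B : BlockSum R H)
    (C : ChainComplex (Rep.{u} R (G × H)) ℤ) : Prop where
  bimodule : ∀ n, IsBimodule A B (C.X n)
  bounded : ∃ a b : ℤ, ∀ n, n < a ∨ b < n → IsZero (C.X n)

lemma IsBimodule.of_total {A : BlockSum R G} {B : BlockSum R H} {M N L : Rep.{u} R (G × H)}
    (hM : IsBimodule A B M) (hN : IsBimodule A B N) (p : L ⟶ M) (q : L ⟶ N) (i : M ⟶ L) (j : N ⟶ L)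
    (h : p ≫ i + q ≫ j = 𝟙 L) : IsBimodule A B L := by
  have key : ∀ x : L, i.hom (p.hom x) + j.hom (q.hom x) = x := fun x =>
    congrArg (fun f : L ⟶ L => f.hom x) h
  refine ⟨?_, ?_, ?_⟩
  · have := hM.finite
    have := hN.finite
    refine Module.Finite.of_surjective
      (LinearMap.coprod i.hom.toLinearMap j.hom.toLinearMap) fun x => ⟨(p.hom x, q.hom x), key x⟩
  · ext x
    have h1 := hom_leftAct i A.idem (p.hom x)
    have h2 := hom_leftAct j A.idem (q.hom x)
    rw [hM.left] at h1
    rw [hN.left] at h2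
    change leftAct L A.idem x = x
    conv_lhs => rw [← key x, map_add, ← h1, ← h2]
    exact key x
  · ext x
    have h1 := hom_rightAct i B.idem (p.hom x)
    have h2 := hom_rightAct j B.idem (q.hom x)
    rw [hM.right] at h1
    rw [hN.right] at h2
    change rightAct L B.idem x = x
    conv_lhs => rw [← key x, map_add, ← h1, ← h2]
    exact key x

lemma IsBimoduleComplex.biprod {A : BlockSum R G} {B : BlockSum R H}
    {C D : ChainComplex (Rep.{u} R (G × H)) ℤ}
    (hC : IsBimoduleComplex A B C) (hD : IsBimoduleComplex A B D) :
    IsBimoduleComplex A B (C ⊞ D) := by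
  have key : ∀ n, (Limits.biprod.fst : C ⊞ D ⟶ C).f n ≫ (Limits.biprod.inl : C ⟶ C ⊞ D).f n +
      (Limits.biprod.snd : C ⊞ D ⟶ D).f n ≫ (Limits.biprod.inr : D ⟶ C ⊞ D).f n =
        𝟙 ((C ⊞ D).X n) := fun n =>
    congrArg (fun f : C ⊞ D ⟶ C ⊞ D => f.f n) (biprod.total (X := C) (Y := D))
  refine ⟨fun n => (hC.bimodule n).of_total (hD.bimodule n) _ _ _ _ (key n), ?_⟩
  obtain ⟨a, b, hab⟩ := hC.bounded
  obtain ⟨a', b', hab'⟩ := hD.bounded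
  refine ⟨min a a', max b b', fun n hn => ?_⟩
  have h1 := hab n (by lia)
  have h2 := hab' n (by lia)
  rw [IsZero.iff_id_eq_zero, ← key n, h1.eq_zero_of_tgt ((Limits.biprod.fst : C ⊞ D ⟶ C).f n),
    h2.eq_zero_of_tgt ((Limits.biprod.snd : C ⊞ D ⟶ D).f n), zero_comp, zero_comp, add_zero]

/-- A splendid Rickard complex for `A = RG e` and `B = RH f`. -/
structure IsSplendidRickardComplex (p : ℕ) (A : BlockSum R G) (B : BlockSum R H)
    (C : ChainComplex (Rep.{u} R (G × H)) ℤ) : Prop where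
  bimoduleComplex : IsBimoduleComplex A B C
  pPermutation : ∀ n, IsPPermutationModule p (C.X n)
  vertex : ∀ (n : ℤ) (M : Rep.{u} R (G × H)), IsDirectSummand M (C.X n) → Indecomposable M →
    ∃ X : Subgroup (G × H), IsTwistedDiagonal X ∧ IsVertex X M
  tensor_dual : Nonempty (HomotopyEquiv (tensorComplex C (dualComplex C))
    ((HomologicalComplex.single _ (ComplexShape.down ℤ) 0).obj A.bimodule))
  dual_tensor : Nonempty (HomotopyEquiv (tensorComplex (dualComplex C) C)
    ((HomologicalComplex.single _ (ComplexShape.down ℤ) 0).obj B.bimodule))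

/-- The objects of the homotopy category of complexes of `(RG, RH)`-bimodules that are bounded
complexes of finitely generated `(A, B)`-bimodules. -/
def homotopyProperty (A : BlockSum R G) (B : BlockSum R H) :
    ObjectProperty (HomotopyCategory (Rep.{u} R (G × H)) (ComplexShape.down ℤ)) :=
  fun X => IsBimoduleComplex A B X.as

/-- The bounded homotopy category `K^b` of finitely generated `(A, B)`-bimodules. -/
abbrev BoundedHomotopyCategory (A : BlockSum R G) (B : BlockSum R H) :=
  (homotopyProperty A B).FullSubcategory

/-- A bounded complex of finitely generated `(A, B)`-bimodules as an object of `K^b`. -/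
def toHomotopyCategory {A : BlockSum R G} {B : BlockSum R H}
    (C : ChainComplex (Rep.{u} R (G × H)) ℤ) (hC : IsBimoduleComplex A B C) :
    BoundedHomotopyCategory A B :=
  ⟨(HomotopyCategory.quotient _ _).obj C, hC⟩

instance hasBinaryBiproducts_boundedHomotopyCategory (A : BlockSum R G) (B : BlockSum R H) :
    HasBinaryBiproducts (BoundedHomotopyCategory A B) where
  has_binary_biproduct X Y := by
    let F := HomotopyCategory.quotient (Rep.{u} R (G × H)) (ComplexShape.down ℤ)
    let S : ChainComplex (Rep.{u} R (G × H)) ℤ := X.obj.as ⊞ Y.obj.as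
    have hS : IsBimoduleComplex A B S := X.property.biprod Y.property
    have hF : ∀ {P Q L : ChainComplex (Rep.{u} R (G × H)) ℤ} {f : P ⟶ Q} {g : Q ⟶ L} {k : P ⟶ L},
        f ≫ g = k → F.map f ≫ F.map g = F.map k := fun h => by rw [← F.map_comp, h]
    have hT : ∀ P Q : ChainComplex (Rep.{u} R (G × H)) ℤ,
        F.map (biprod.fst : P ⊞ Q ⟶ P) ≫ F.map biprod.inl +
          F.map (biprod.snd : P ⊞ Q ⟶ Q) ≫ F.map biprod.inr = 𝟙 (F.obj (P ⊞ Q)) := fun P Q => by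
      rw [← F.map_comp, ← F.map_comp, ← F.map_add, biprod.total, F.map_id]
    let b : BinaryBicone X Y :=
      { pt := toHomotopyCategory S hS
        fst := ObjectProperty.homMk (F.map biprod.fst)
        snd := ObjectProperty.homMk (F.map biprod.snd)
        inl := ObjectProperty.homMk (F.map biprod.inl)
        inr := ObjectProperty.homMk (F.map biprod.inr)
        inl_fst := ObjectProperty.hom_ext _ ((hF biprod.inl_fst).trans (F.map_id _))
        inl_snd := ObjectProperty.hom_ext _ ((hF biprod.inl_snd).trans (F.map_zero _ _))
        inr_fst := ObjectProperty.hom_ext _ ((hF biprod.inr_fst).trans (F.map_zero _ _))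
        inr_snd := ObjectProperty.hom_ext _ ((hF biprod.inr_snd).trans (F.map_id _)) }
    exact HasBinaryBiproduct.mk
      ⟨b, isBinaryBilimitOfTotal b (ObjectProperty.hom_ext _ (hT X.obj.as Y.obj.as))⟩

end Complexes

end Splendid

end

/-! Suppose that `C` splits up to homotopy into `Y` and `Z`. The functor `C^* ⊗ -` turns the
projection onto `Y` into an idempotent endomorphism, up to homotopy, of `C^* ⊗ C ≃ B`. For a complex
concentrated in degree `0` homotopic maps are equal, and bimodule endomorphisms of `B = RHf` are
multiplications by central elements, so primitivity of `f` leaves only `0` and `1`. Hence `C^* ⊗ Y`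
or `C^* ⊗ Z` is contractible (`contractible_or_contractible`). Tensoring back with `C` and using `C
⊗ C^* ≃ A`, the complex `A ⊗ Y` or `A ⊗ Z` is contractible, and so is its retract `Y` or `Z`
(`contractible_of_dual_tensor`). As `C` itself is not contractible, it is indecomposable in `K^b`.

For chain complexes, induction on a total rank gives an indecomposable noncontractible summand `D`,
and by the same argument its complement is contractible. So `D ≃ C`, and both tensor conditions pass
to `D`, since duals and tensor products respect homotopy equivalences. The vertex condition passes
to summands of the terms. The `p`-permutation condition does too, because over a complete local
domain of residue characteristic `p` summands of permutation modules of `p`-groups are permutation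
modules (`IsPermutationModule.of_isDirectSummand`).

Uniqueness is a Krull–Schmidt argument: endomorphism algebras are finite over a complete Noetherian
local ring, so those of indecomposable objects are local (`isLocalRing_of_isIdempotentElem`).
Another indecomposable noncontractible summand is therefore a summand of `D` or of its contractible
complement, and the latter is impossible. -/

noncomputable section

namespace Splendid

/-! ### Finite algebras over a complete local ring: lifting idempotents -/

section LocalAlgebras

open IsLocalRing

variable {R : Type*} [CommRing R] [IsLocalRing R] [IsAdicComplete (maximalIdeal R) R]

/-- For finite `M`, the completion of `R` tensored with `M` maps onto the completion of `M`. As `R`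
already maps onto its own completion, every point of the completion of `M` comes from `M`. -/
lemma isPrecomplete_of_finite (M : Type*) [AddCommGroup M] [Module R M] [Module.Finite R M] :
    IsPrecomplete (maximalIdeal R) M := by
  rw [← AdicCompletion.of_surjective_iff]
  intro y
  obtain ⟨t, rfl⟩ := AdicCompletion.ofTensorProduct_surjective_of_finite (maximalIdeal R) M y
  induction t using TensorProduct.induction_on with
  | zero => exact ⟨0, by simp⟩
  | tmul a m =>
    obtain ⟨r, rfl⟩ := AdicCompletion.of_surjective (maximalIdeal R) R a
    refine ⟨r • m, ?_⟩
    rw [AdicCompletion.ofTensorProduct_tmul]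
    exact map_smul _ r m
  | add a b ha hb =>
    obtain ⟨x, hx⟩ := ha
    obtain ⟨y, hy⟩ := hb
    exact ⟨x + y, by rw [map_add, map_add, hx, hy]⟩

variable [IsNoetherianRing R]

lemma isAdicComplete_map_of_finite (S : Type*) [CommRing S] [Algebra R S] [Module.Finite R S] :
    IsAdicComplete ((maximalIdeal R).map (algebraMap R S)) S where
  toIsHausdorff := (IsHausdorff.map_algebraMap_iff).2 inferInstance
  toIsPrecomplete := (IsPrecomplete.map_algebraMap_iff).2 (isPrecomplete_of_finite S)

/-- An element of a commutative Artinian ring without non-trivial idempotents is a unit or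
nilpotent; this version keeps track of the idempotent. -/
lemma exists_isIdempotentElem_of_isArtinian {S : Type*} [CommRing S] [IsArtinianRing S] (x : S) :
    ∃ e : S, IsIdempotentElem e ∧ (e = 1 → IsUnit x) ∧ (e = 0 → IsUnit (1 - x)) := by
  -- The ideals generated by the powers of `x` stabilise, so `x ^ (n + 1) * y = x ^ n` for some `n`
  -- and `y`. Then `x ^ n * y ^ n` is an idempotent generating the same ideal as `x ^ n`; if it is
  -- `0`, then `x` is nilpotent.
  obtain ⟨n, y, hy⟩ := IsArtinian.exists_pow_succ_smul_dvd x (1 : S)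
  have h1 : x ^ n * (x * y) = x ^ n := by
    rw [← mul_assoc, ← pow_succ]
    simpa using hy
  have h2 : ∀ k : ℕ, x ^ n * (x * y) ^ k = x ^ n := fun k => by
    induction k with
    | zero => simp
    | succ k ih => rw [pow_succ, ← mul_assoc, ih, h1]
  have h3 : x ^ n * (x ^ n * y ^ n) = x ^ n := by rw [← mul_pow, h2]
  refine ⟨x ^ n * y ^ n, ?_, fun h => ?_, fun h => ?_⟩
  · change x ^ n * y ^ n * (x ^ n * y ^ n) = _
    calc _ = x ^ n * (x ^ n * y ^ n) * y ^ n := by ring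
      _ = _ := by rw [h3]
  · refine IsUnit.of_mul_eq_one y ?_
    calc x * y = (x ^ n * y ^ n) * (x * y) := by rw [h, one_mul]
      _ = x ^ n * (x * y) * y ^ n := by ring
      _ = 1 := by rw [h1, h]
  · rw [h, mul_zero] at h3
    exact IsNilpotent.isUnit_one_sub ⟨n, h3.symm⟩

/-- In a commutative finite algebra over a complete local ring without non-trivial idempotents, `x`
or `1 - x` is a unit. -/
lemma isUnit_or_isUnit_one_sub_of_comm (S : Type*) [CommRing S] [Algebra R S]
    [Module.Finite R S] (hS : ∀ e : S, IsIdempotentElem e → e = 0 ∨ e = 1) (x : S) :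
    IsUnit x ∨ IsUnit (1 - x) := by
  -- The quotient by `I` is finite over the residue field, hence Artinian, and `I` lies in the
  -- Jacobson radical, so units can be detected modulo `I`. It remains to lift the idempotent
  -- attached to `x` from the quotient to `S`.
  let I : Ideal S := (maximalIdeal R).map (algebraMap R S)
  have : IsAdicComplete I S := isAdicComplete_map_of_finite S
  have hI : I ≤ Ideal.jacobson ⊥ := IsAdicComplete.le_jacobson_bot I
  have : IsLocalHom (Ideal.Quotient.mk I) := isLocalHom_of_le_jacobson_bot I hI
  have : Module.Finite (R ⧸ maximalIdeal R) (S ⧸ I) :=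
    Module.Finite.of_restrictScalars_finite R _ _
  have : IsArtinianRing (R ⧸ maximalIdeal R) := inferInstanceAs (IsArtinianRing (ResidueField R))
  have : IsArtinianRing (S ⧸ I) := IsArtinianRing.of_finite (R ⧸ maximalIdeal R) _
  obtain ⟨e, he, he1, he0⟩ := exists_isIdempotentElem_of_isArtinian (Ideal.Quotient.mk I x)
  obtain ⟨e, rfl⟩ := Ideal.Quotient.mk_surjective e
  -- Hensel's lemma for `X ^ 2 - X`, whose derivative at `e` is `2 * e - 1`. This is its own inverse
  -- modulo `I`, because its square is `4 * (e ^ 2 - e) + 1`.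
  obtain ⟨a, ha, hae⟩ := HenselianRing.is_henselian (I := I) (Polynomial.X ^ 2 - Polynomial.X)
    (by monicity!) e
    (by
      rw [← Ideal.Quotient.eq_zero_iff_mem]
      simp [pow_two, he.eq])
    (by
      refine IsUnit.of_mul_eq_one (Ideal.Quotient.mk I (2 * e - 1)) ?_
      have h : (Polynomial.derivative (Polynomial.X ^ 2 - Polynomial.X : Polynomial S)).eval e =
          2 * e - 1 := by simp [one_add_one_eq_two]
      rw [h]
      simp only [map_sub, map_mul, map_one, map_ofNat]
      linear_combination 4 * he.eq)
  have h4 : Ideal.Quotient.mk I a = Ideal.Quotient.mk I e := Ideal.Quotient.eq.2 hae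
  have h5 : IsIdempotentElem a := by
    have : a ^ 2 - a = 0 := by simpa using ha
    rw [IsIdempotentElem, ← pow_two]
    linear_combination this
  rw [← h4] at he0 he1
  obtain rfl | rfl := hS a h5
  · right
    exact isUnit_of_map_unit (Ideal.Quotient.mk I) _ (by simpa using he0 (map_zero _))
  · left
    exact isUnit_of_map_unit (Ideal.Quotient.mk I) _ (he1 (map_one _))

/-- A finite algebra over a complete Noetherian local ring without non-trivial idempotents is
local. -/
theorem isLocalRing_of_isIdempotentElem (E : Type*) [Ring E] [Nontrivial E] [Algebra R E]
    [Module.Finite R E] (hE : ∀ e : E, IsIdempotentElem e → e = 0 ∨ e = 1) : IsLocalRing E := by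
  refine IsLocalRing.of_isUnit_or_isUnit_one_sub_self fun x => ?_
  -- Being local is tested on one element at a time, so the commutative subalgebra generated by `x`
  -- suffices. It is finite because `R` is Noetherian, and its idempotents are idempotents of `E`.
  let S := Algebra.adjoin R {x}
  have : IsMulCommutative S := Algebra.isMulCommutative_adjoin R (by
    rintro a rfl b rfl
    rfl)
  have : Module.Finite R S := Module.Finite.of_injective S.val.toLinearMap Subtype.val_injective
  have h := isUnit_or_isUnit_one_sub_of_comm (R := R) S (fun e he => by
    obtain h | h := hE e (congrArg Subtype.val he)
    · exact Or.inl (Subtype.ext h)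
    · exact Or.inr (Subtype.ext h)) ⟨x, Algebra.subset_adjoin rfl⟩
  exact h.imp (fun h => h.map S.val) (fun h => by simpa using h.map S.val)

end LocalAlgebras

/-! ### Direct summands as retracts, and Krull–Schmidt arguments -/

section DirectSummands

variable {𝓒 : Type*} [Category 𝓒] [Abelian 𝓒] {X Y Z : 𝓒}

lemma IsDirectSummand.nonempty_retract (h : IsDirectSummand X Y) : Nonempty (Retract X Y) := by
  obtain ⟨Z, ⟨e⟩⟩ := h
  exact ⟨{ i := biprod.inl ≫ e.inv, r := e.hom ≫ biprod.fst }⟩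

/-- The complement is the image of the complementary idempotent `𝟙 Y - h.r ≫ h.i`. The compatibility
with `h.i` and `h.r` is kept so that the idempotent can be recovered from the decomposition. -/
lemma exists_biprod_iso_of_retract (h : Retract X Y) :
    ∃ (Z : 𝓒) (e : Y ≅ X ⊞ Z), biprod.inl ≫ e.inv = h.i ∧ e.hom ≫ biprod.fst = h.r := by
  have hi : (h.r ≫ h.i) ≫ (h.r ≫ h.i) = h.r ≫ h.i := by simp
  obtain ⟨Z, j, q, hjq, hqj⟩ := IsIdempotentComplete.idempotents_split Y (𝟙 Y - h.r ≫ h.i)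
    (Idempotents.idem_of_id_sub_idem _ hi)
  have : Mono j := (SplitMono.mk q hjq).mono
  have : Epi q := (SplitEpi.mk j hjq).epi
  let b : BinaryBicone X Z :=
    { pt := Y
      fst := h.r
      snd := q
      inl := h.i
      inr := j
      inl_fst := h.retract
      inl_snd := by
        rw [← cancel_mono j, Category.assoc, hqj, Preadditive.comp_sub, h.retract_assoc]
        simp
      inr_fst := by
        rw [← cancel_epi q, reassoc_of% hqj, Preadditive.sub_comp, Category.assoc, h.retract]
        simp
      inr_snd := hjq }
  have hb : b.IsBilimit := isBinaryBilimitOfTotal b (by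
    change h.r ≫ h.i + q ≫ j = 𝟙 Y
    rw [hqj]
    abel)
  exact ⟨Z, biprod.uniqueUpToIso X Z hb, by simp [b], by simp [b]⟩

lemma IsDirectSummand.of_retract (h : Retract X Y) : IsDirectSummand X Y := by
  obtain ⟨Z, e, -⟩ := exists_biprod_iso_of_retract h
  exact ⟨Z, ⟨e⟩⟩

lemma IsDirectSummand.trans (h : IsDirectSummand X Y) (h' : IsDirectSummand Y Z) :
    IsDirectSummand X Z := by
  obtain ⟨r⟩ := h.nonempty_retract
  obtain ⟨r'⟩ := h'.nonempty_retract
  exact .of_retract (r.trans r')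

lemma isDirectSummand_refl (X : 𝓒) : IsDirectSummand X X := .of_retract (Retract.refl X)

lemma IsDirectSummand.left (e : X ≅ Y ⊞ Z) : IsDirectSummand Y X := ⟨Z, ⟨e⟩⟩

lemma IsDirectSummand.right (e : X ≅ Y ⊞ Z) : IsDirectSummand Z X :=
  ⟨Y, ⟨e ≪≫ biprod.braiding Y Z⟩⟩

lemma IsDirectSummand.map {𝓓 : Type*} [Category 𝓓] [Abelian 𝓓] (F : 𝓒 ⥤ 𝓓)
    (h : IsDirectSummand X Y) : IsDirectSummand (F.obj X) (F.obj Y) := by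
  obtain ⟨r⟩ := h.nonempty_retract
  exact .of_retract (r.map F)

/-- The only idempotent endomorphisms of an indecomposable object are the trivial ones. -/
lemma eq_zero_or_eq_id_of_indecomposable (hX : Indecomposable X) (e : X ⟶ X) (he : e ≫ e = e) :
    e = 0 ∨ e = 𝟙 X := by
  -- The image of `e` is a summand of `X`, so it or its complement is zero. In the first case `e =
  -- 0`; in the second `e` is the whole identity of the biproduct.
  obtain ⟨Y, i, q, hiq, hqi⟩ := IsIdempotentComplete.idempotents_split X e he
  obtain ⟨Z, t, ht1, ht2⟩ := exists_biprod_iso_of_retract (Retract.mk i q hiq)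
  dsimp at ht1 ht2
  obtain h | h := hX.2 Y Z t
  · left
    rw [← hqi, h.eq_zero_of_src i, comp_zero]
  · right
    have h1 : 𝟙 X = t.hom ≫ (biprod.fst ≫ biprod.inl + biprod.snd ≫ biprod.inr) ≫ t.inv := by
      simp
    rw [h.eq_zero_of_src (biprod.inr : Z ⟶ Y ⊞ Z), comp_zero, add_zero, Category.assoc, ht1,
      reassoc_of% ht2, hqi] at h1
    exact h1.symm

/-- A nonzero retract of an indecomposable object is isomorphic to it. -/
lemma nonempty_iso_of_retract_indecomposable (h : Retract X Y) (hX : ¬ IsZero X)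
    (hY : Indecomposable Y) : Nonempty (X ≅ Y) := by
  obtain h0 | h1 := eq_zero_or_eq_id_of_indecomposable hY (h.r ≫ h.i) (by simp)
  · refine (hX ?_).elim
    rw [IsZero.iff_id_eq_zero]
    calc 𝟙 X = h.i ≫ (h.r ≫ h.i) ≫ h.r := by simp
      _ = 0 := by rw [h0, zero_comp, comp_zero]
  · exact ⟨⟨h.i, h.r, h.retract, h1⟩⟩

open IsLocalRing in
/-- An indecomposable object with a finite endomorphism algebra over a complete local ring has a
local endomorphism ring. -/
lemma isLocalRing_end_of_indecomposable {R : Type*} [CommRing R] [IsLocalRing R]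
    [IsNoetherianRing R] [IsAdicComplete (maximalIdeal R) R] [Linear R 𝓒]
    (hX : Indecomposable X) [Module.Finite R (End X)] : IsLocalRing (End X) := by
  have : Nontrivial (End X) := ⟨0, 𝟙 X, fun h => hX.1 ((IsZero.iff_id_eq_zero X).2 h.symm)⟩
  exact isLocalRing_of_isIdempotentElem (R := R) (End X) fun e he =>
    eq_zero_or_eq_id_of_indecomposable hX e he

lemma exists_isUnit_of_isUnit_sum {E ι : Type*} [Ring E] [IsLocalRing E] (s : Finset ι)
    (f : ι → E) (h : IsUnit (∑ i ∈ s, f i)) : ∃ i ∈ s, IsUnit (f i) := by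
  classical
  induction s using Finset.induction_on with
  | empty => simp at h
  | insert a s ha ih =>
    rw [Finset.sum_insert ha] at h
    obtain ⟨u, hu⟩ := h
    have h1 : ↑u⁻¹ * f a + ↑u⁻¹ * ∑ i ∈ s, f i = 1 := by rw [← mul_add, ← hu, Units.inv_mul]
    obtain h2 | h2 := IsLocalRing.isUnit_or_isUnit_of_add_one h1
    · exact ⟨a, by simp, by simpa using h2⟩
    · obtain ⟨i, hi, hi'⟩ := ih (by simpa using h2)
      exact ⟨i, by simp [hi], hi'⟩

/-- If the identity of an object `X` with local endomorphism ring is a sum of endomorphisms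
`aᵢ ≫ bᵢ` that factor through objects `Yᵢ`, then `X` is a retract of some `Yᵢ`. -/
lemma exists_retract_of_sum_eq_id [IsLocalRing (End X)] {ι : Type*} (s : Finset ι) (W : ι → 𝓒)
    (a : ∀ i, X ⟶ W i) (b : ∀ i, W i ⟶ X) (h : ∑ i ∈ s, a i ≫ b i = 𝟙 X) :
    ∃ i ∈ s, Nonempty (Retract X (W i)) := by
  obtain ⟨i, hi, h⟩ := exists_isUnit_of_isUnit_sum (E := End X) s (fun i => a i ≫ b i)
    (h ▸ isUnit_one (M := End X))
  have : IsIso (a i ≫ b i) := (isUnit_iff_isIso _).1 h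
  exact ⟨i, hi, ⟨a i, b i ≫ inv (a i ≫ b i), by rw [← Category.assoc, IsIso.hom_inv_id]⟩⟩

/-- The identity of `X` is the sum of an endomorphism through `Y` and one through `Z`; in a local
ring one of them is a unit. This exchange property drives the uniqueness statement. -/
lemma IsDirectSummand.left_or_right [IsLocalRing (End X)] (h : IsDirectSummand X (Y ⊞ Z)) :
    IsDirectSummand X Y ∨ IsDirectSummand X Z := by
  obtain ⟨r⟩ := h.nonempty_retract
  have h1 : r.i ≫ (biprod.fst ≫ biprod.inl + biprod.snd ≫ biprod.inr) ≫ r.r = 𝟙 X := by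
    rw [biprod.total, Category.id_comp, r.retract]
  rw [Preadditive.add_comp, Preadditive.comp_add, Category.assoc, Category.assoc,
    ← Category.assoc, ← Category.assoc r.i] at h1
  obtain h2 | h2 := IsLocalRing.isUnit_or_isUnit_of_add_one (R := End X) h1
  · have : IsIso ((r.i ≫ biprod.fst) ≫ biprod.inl ≫ r.r) := (isUnit_iff_isIso _).1 h2
    exact Or.inl (.of_retract ⟨r.i ≫ biprod.fst, (biprod.inl ≫ r.r) ≫ inv _,
      by rw [← Category.assoc, IsIso.hom_inv_id]⟩)
  · have : IsIso ((r.i ≫ biprod.snd) ≫ biprod.inr ≫ r.r) := (isUnit_iff_isIso _).1 h2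
    exact Or.inr (.of_retract ⟨r.i ≫ biprod.snd, (biprod.inr ≫ r.r) ≫ inv _,
      by rw [← Category.assoc, IsIso.hom_inv_id]⟩)

end DirectSummands

/-! ### Permutation modules of `p`-groups -/

section PermutationModules

/-- A stable matrix all of whose rows have sum `1`, for a transitive action of a `p`-group, is
invertible over a local ring of residue characteristic `p`. -/
lemma isUnit_det_of_stable {p : ℕ} [Fact p.Prime] {R : Type*} [CommRing R] [IsLocalRing R]
    [CharP (IsLocalRing.ResidueField R) p] {P ω : Type*} [Group P] (hP : IsPGroup p P)
    [MulAction P ω] [MulAction.IsPretransitive P ω] [Fintype ω] [DecidableEq ω]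
    (F : Matrix ω ω R) (hF : ∀ (g : P) x y, F (g • x) (g • y) = F x y)
    (h1 : ∀ x, ∑ y, F x y = 1) : IsUnit F.det := by
  let k := IsLocalRing.ResidueField R
  let F' : Matrix ω ω k := F.map (IsLocalRing.residue R)
  have hdet : F'.det = IsLocalRing.residue R F.det := ((IsLocalRing.residue R).map_det F).symm
  have hF' : ∀ (g : P) x y, F' (g • x) (g • y) = F' x y := fun g x y =>
    congrArg (IsLocalRing.residue R) (hF g x y)
  have h1' : ∀ x, ∑ y, F' x y = 1 := fun x => by
    have h := congrArg (IsLocalRing.residue R) (h1 x)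
    rwa [map_sum, map_one] at h
  by_contra hu
  have h0 : F'.det = 0 := by
    rw [hdet, IsLocalRing.residue_eq_zero_iff]
    exact hu
  obtain ⟨v, hv0, hv⟩ := Matrix.exists_mulVec_eq_zero_iff.2 h0
  -- The residue field may be infinite, so fixed points cannot be counted in the kernel of `F'`
  -- directly. The kernel vectors with entries in the `𝔽_p`-span of the entries of `v` form a finite
  -- nonzero `𝔽_p`-space, and stability of `F'` makes it `P`-stable.
  let _ : Algebra (ZMod p) k := ZMod.algebra k p
  let K : Submodule (ZMod p) k := Submodule.span (ZMod p) (Set.range v)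
  have : Module.Finite (ZMod p) K := Module.Finite.span_of_finite _ (Set.finite_range v)
  let A : Submodule (ZMod p) (ω → k) :=
    Submodule.pi Set.univ (fun _ => K) ⊓
      LinearMap.ker ((Matrix.mulVecLin F').restrictScalars (ZMod p))
  have hA : ∀ w : ω → k, w ∈ A ↔ (∀ x, w x ∈ K) ∧ F'.mulVec w = 0 := fun w => by
    simp [A, Submodule.mem_pi]
  have hvA : v ∈ A := (hA v).2 ⟨fun x => Submodule.subset_span ⟨x, rfl⟩, hv⟩
  have : Finite K := Module.finite_of_finite (ZMod p)
  have : Finite A := Finite.of_injective (fun (w : A) (x : ω) => (⟨w.1 x, ((hA _).1 w.2).1 x⟩ : K))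
    fun w w' h => Subtype.ext (funext fun x => congrArg Subtype.val (congrFun h x))
  let _ : MulAction P A :=
    { smul g w := ⟨fun x => w.1 (g⁻¹ • x), (hA _).2 ⟨fun x => ((hA _).1 w.2).1 _, by
        ext x
        have h := congrFun ((hA _).1 w.2).2 (g⁻¹ • x)
        simp only [Matrix.mulVec, dotProduct, Pi.zero_apply] at h ⊢
        rw [← h]
        refine Fintype.sum_equiv (MulAction.toPerm g⁻¹) _ _ fun y => ?_
        simp only [MulAction.toPerm_apply]
        rw [hF']⟩⟩
      one_smul w := Subtype.ext (funext fun x => by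
        change w.1 ((1 : P)⁻¹ • x) = w.1 x
        simp)
      mul_smul g h w := Subtype.ext (funext fun x => by
        change w.1 ((g * h)⁻¹ • x) = w.1 (h⁻¹ • g⁻¹ • x)
        rw [mul_inv_rev, mul_smul]) }
  have hsmul : ∀ (g : P) (w : A) (x : ω), (g • w).1 x = w.1 (g⁻¹ • x) := fun _ _ _ => rfl
  have : Module.Finite (ZMod p) A := Module.Finite.of_finite
  have : Nontrivial A := ⟨⟨v, hvA⟩, 0, fun h => hv0 (congrArg Subtype.val h)⟩
  have hcard : p ∣ Nat.card A := by
    rw [Module.natCard_eq_pow_finrank (K := ZMod p), Nat.card_zmod]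
    exact dvd_pow_self _ Module.finrank_pos.ne'
  -- A `p`-group acting on a set of cardinality divisible by `p` with the fixed point `0` has
  -- another one. It is constant by transitivity, so the row sums give `F' w = w`, contradicting `F'
  -- w = 0`.
  obtain ⟨w, hw, hw0⟩ := hP.exists_fixed_point_of_prime_dvd_card_of_fixed_point A hcard
    (a := 0) (fun g => Subtype.ext (funext fun x => rfl))
  have hw1 : ∀ x y, w.1 x = w.1 y := fun x y => by
    obtain ⟨g, rfl⟩ := MulAction.exists_smul_eq P x y
    have h := congrArg (fun w : A => w.1 x) (hw g⁻¹)
    simp only [hsmul, inv_inv] at h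
    exact h.symm
  apply hw0
  ext x
  have h := congrFun ((hA _).1 w.2).2 x
  simp only [Matrix.mulVec, dotProduct, Pi.zero_apply] at h
  rw [Finset.sum_congr rfl fun y _ => by rw [hw1 y x], ← Finset.sum_mul, h1', one_mul] at h
  exact h.symm

/-- By transitivity all row sums agree, and their common value is idempotent, hence `0` or `1` in a
domain. If it is `1`, then `F` is invertible and idempotent; if it is `0`, the same applies to `1 -
F`. -/
lemma eq_zero_or_eq_one_of_stable {p : ℕ} [Fact p.Prime] {R : Type*} [CommRing R] [IsDomain R]
    [IsLocalRing R]
    [CharP (IsLocalRing.ResidueField R) p] {P ω : Type*} [Group P] (hP : IsPGroup p P)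
    [MulAction P ω] [MulAction.IsPretransitive P ω] [Fintype ω] [DecidableEq ω]
    (F : Matrix ω ω R) (hF : ∀ (g : P) x y, F (g • x) (g • y) = F x y) (hi : F * F = F) :
    F = 0 ∨ F = 1 := by
  have key : ∀ F : Matrix ω ω R, (∀ (g : P) x y, F (g • x) (g • y) = F x y) → F * F = F →
      (∀ x, ∑ y, F x y = 1) → F = 1 := fun F hF hi h1 => by
    have hu := (Matrix.isUnit_iff_isUnit_det F).2 (isUnit_det_of_stable hP F hF h1)
    exact hu.mul_left_cancel (by rw [hi, mul_one])
  obtain h | ⟨⟨x0⟩⟩ := isEmpty_or_nonempty ω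
  · exact Or.inl (Subsingleton.elim _ _)
  have hc : ∀ x, ∑ y, F x y = ∑ y, F x0 y := fun x => by
    obtain ⟨g, rfl⟩ := MulAction.exists_smul_eq P x0 x
    refine (Fintype.sum_equiv (MulAction.toPerm g) _ _ fun y => ?_).symm
    rw [MulAction.toPerm_apply, hF]
  have hcc : (∑ y, F x0 y) * (∑ y, F x0 y) = ∑ y, F x0 y := by
    conv_rhs => rw [← hi]
    simp only [Matrix.mul_apply]
    rw [Finset.sum_comm, Finset.sum_mul]
    refine Finset.sum_congr rfl fun y _ => ?_
    rw [← Finset.mul_sum, hc y]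
  obtain h0 | h1 := IsIdempotentElem.iff_eq_zero_or_one.1 hcc
  · left
    have h := key (1 - F) (fun g x y => by
        simp [Matrix.sub_apply, hF, Matrix.one_apply]) (by
        exact IsIdempotentElem.one_sub hi) (fun x => by
        simp [Matrix.sub_apply, Finset.sum_sub_distrib, hc x, h0, Matrix.one_apply])
    simpa using h
  · exact Or.inr (key F hF hi fun x => (hc x).trans h1)

variable {R : Type u} [CommRing R] {P : Type u} [Group P]

lemma permutationHom_ext {X : Type u} [MulAction P X] {M : Rep.{u} R P}
    {f g : Rep.ofMulAction R P X ⟶ M}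
    (h : ∀ x, f.hom (MonoidAlgebra.single x 1) = g.hom (MonoidAlgebra.single x 1)) : f = g := by
  apply Rep.hom_ext
  apply Representation.IntertwiningMap.toLinearMap_injective
  exact MonoidAlgebra.lhom_ext' fun x => LinearMap.ext_ring (h x)

/-- An idempotent endomorphism of a transitive permutation module of a `p`-group is trivial. -/
lemma permutationHom_eq_zero_or_eq_id {p : ℕ} [Fact p.Prime] [IsDomain R] [IsLocalRing R]
    [CharP (IsLocalRing.ResidueField R) p] (hP : IsPGroup p P) {ω : Type u} [Finite ω]
    [MulAction P ω] [MulAction.IsPretransitive P ω]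
    (f : Rep.ofMulAction R P ω ⟶ Rep.ofMulAction R P ω) (hf : f ≫ f = f) : f = 0 ∨ f = 𝟙 _ := by
  classical
  have := Fintype.ofFinite ω
  let b : Module.Basis ω R (MonoidAlgebra R ω) := .ofRepr (MonoidAlgebra.coeffLinearEquiv R)
  have hb : ∀ x, b x = MonoidAlgebra.single x 1 := fun x => rfl
  -- In the permutation basis, equivariance of `f` is exactly invariance of its matrix under
  -- simultaneous translation of rows and columns.
  let F := LinearMap.toMatrix b b f.hom.toLinearMap
  have hFi : F * F = F := by
    rw [← LinearMap.toMatrix_comp]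
    congr 1
    exact congrArg (fun f : Rep.ofMulAction R P ω ⟶ Rep.ofMulAction R P ω => f.hom.toLinearMap) hf
  have hF : ∀ (g : P) x y, F (g • x) (g • y) = F x y := fun g x y => by
    simp only [F, LinearMap.toMatrix_apply, hb]
    have h := Rep.hom_comm_apply f g (MonoidAlgebra.single y 1)
    change (f.hom (MonoidAlgebra.single (g • y) 1)).coeff (g • x) =
      (f.hom (MonoidAlgebra.single y 1)).coeff x
    rw [Representation.ofMulAction_single] at h
    rw [h, Representation.coeff_ofMulAction, inv_smul_smul]
  have hinj : ∀ f g : Rep.ofMulAction R P ω ⟶ Rep.ofMulAction R P ω,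
      f.hom.toLinearMap = g.hom.toLinearMap → f = g := fun f g h =>
    Rep.hom_ext (Representation.IntertwiningMap.toLinearMap_injective _ _ h)
  obtain h | h := eq_zero_or_eq_one_of_stable hP F hF hFi
  · left
    apply hinj
    exact (LinearMap.toMatrix b b).injective (h.trans (map_zero _).symm)
  · right
    apply hinj
    exact (LinearMap.toMatrix b b).injective (h.trans (LinearMap.toMatrix_one b).symm)

/-- The inclusion of permutation modules induced by an equivariant map. -/
def permutationIncl {S X : Type u} [MulAction P S] [MulAction P X] (i : S → X)
    (hi : ∀ (g : P) s, i (g • s) = g • i s) :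
    Rep.ofMulAction R P S ⟶ Rep.ofMulAction R P X :=
  Rep.ofHom
    ⟨(MonoidAlgebra.coeffLinearEquiv R).symm.toLinearMap ∘ₗ Finsupp.lmapDomain R R i ∘ₗ
      (MonoidAlgebra.coeffLinearEquiv R).toLinearMap, fun g => by
      refine MonoidAlgebra.lhom_ext' fun x => LinearMap.ext_ring ?_
      apply MonoidAlgebra.coeff_injective
      simp [hi, Representation.ofMulAction_single]⟩

lemma permutationIncl_single {S X : Type u} [MulAction P S] [MulAction P X] (i : S → X)
    (hi : ∀ (g : P) s, i (g • s) = g • i s) (s : S) (r : R) :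
    (permutationIncl i hi).hom (MonoidAlgebra.single s r) = MonoidAlgebra.single (i s) r := by
  apply MonoidAlgebra.coeff_injective
  exact Finsupp.mapDomain_single

/-- The restriction of permutation modules to a stable subset. -/
def permutationRestr {S X : Type u} [MulAction P S] [MulAction P X] (i : S → X)
    (hi : ∀ (g : P) s, i (g • s) = g • i s) (hinj : Function.Injective i) :
    Rep.ofMulAction R P X ⟶ Rep.ofMulAction R P S :=
  Rep.ofHom
    ⟨(MonoidAlgebra.coeffLinearEquiv R).symm.toLinearMap ∘ₗ Finsupp.lcomapDomain i hinj ∘ₗ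
      (MonoidAlgebra.coeffLinearEquiv R).toLinearMap, fun g => by
      refine LinearMap.ext fun m => ?_
      apply MonoidAlgebra.coeff_injective
      ext s
      change (Representation.ofMulAction R P X g m).coeff (i s) =
        (Representation.ofMulAction R P S g _).coeff s
      rw [Representation.coeff_ofMulAction, Representation.coeff_ofMulAction, ← hi]
      rfl⟩

lemma coeff_permutationRestr {S X : Type u} [MulAction P S] [MulAction P X] (i : S → X)
    (hi : ∀ (g : P) s, i (g • s) = g • i s) (hinj : Function.Injective i)
    (m : MonoidAlgebra R X) (s : S) :
    ((permutationRestr (R := R) i hi hinj).hom m).coeff s = m.coeff (i s) := rfl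

lemma permutationRestr_single {S X : Type u} [MulAction P S] [MulAction P X] (i : S → X)
    (hi : ∀ (g : P) s, i (g • s) = g • i s) (hinj : Function.Injective i) (s : S) (r : R) :
    (permutationRestr i hi hinj).hom (MonoidAlgebra.single (i s) r) =
      MonoidAlgebra.single s r := by
  classical
  apply MonoidAlgebra.coeff_injective
  ext t
  rw [coeff_permutationRestr, MonoidAlgebra.coeff_single, MonoidAlgebra.coeff_single,
    Finsupp.single_apply, Finsupp.single_apply]
  simp [hinj.eq_iff]

lemma permutationRestr_single_of_notMem {S X : Type u} [MulAction P S] [MulAction P X] (i : S → X)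
    (hi : ∀ (g : P) s, i (g • s) = g • i s) (hinj : Function.Injective i) (x : X) (r : R)
    (hx : x ∉ Set.range i) : (permutationRestr i hi hinj).hom (MonoidAlgebra.single x r) = 0 := by
  classical
  apply MonoidAlgebra.coeff_injective
  ext t
  rw [coeff_permutationRestr, MonoidAlgebra.coeff_single, Finsupp.single_apply, if_neg]
  · rfl
  · rintro rfl
    exact hx ⟨t, rfl⟩

lemma permutationIncl_comp_permutationRestr {S X : Type u} [MulAction P S] [MulAction P X]
    (i : S → X) (hi : ∀ (g : P) s, i (g • s) = g • i s) (hinj : Function.Injective i) :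
    permutationIncl (R := R) i hi ≫ permutationRestr i hi hinj = 𝟙 _ :=
  permutationHom_ext fun x => by
    change (permutationRestr i hi hinj).hom ((permutationIncl i hi).hom _) = _
    rw [permutationIncl_single, permutationRestr_single]
    rfl

lemma permutationIncl_comp_permutationRestr_of_notMem {S T X : Type u} [MulAction P S]
    [MulAction P T] [MulAction P X] (i : S → X) (hi : ∀ (g : P) s, i (g • s) = g • i s) (j : T → X)
    (hj : ∀ (g : P) s, j (g • s) = g • j s) (hinj : Function.Injective j)
    (h : ∀ s, i s ∉ Set.range j) :
    permutationIncl (R := R) i hi ≫ permutationRestr j hj hinj = 0 :=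
  permutationHom_ext fun x => by
    change (permutationRestr j hj hinj).hom ((permutationIncl i hi).hom _) = 0
    rw [permutationIncl_single, permutationRestr_single_of_notMem _ _ _ _ _ (h x)]

lemma permutationProj_single {S X : Type u} [MulAction P S] [MulAction P X]
    (i : S → X) (hi : ∀ (g : P) s, i (g • s) = g • i s) (hinj : Function.Injective i) (x : X)
    (hx : x ∈ Set.range i) (r : R) :
    (permutationRestr i hi hinj ≫ permutationIncl i hi).hom (MonoidAlgebra.single x r) =
      MonoidAlgebra.single x r := by
  obtain ⟨s, rfl⟩ := hx
  change (permutationIncl i hi).hom ((permutationRestr i hi hinj).hom _) = _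
  rw [permutationRestr_single, permutationIncl_single]

lemma permutationProj_single_of_notMem {S X : Type u} [MulAction P S] [MulAction P X]
    (i : S → X) (hi : ∀ (g : P) s, i (g • s) = g • i s) (hinj : Function.Injective i) (x : X)
    (hx : x ∉ Set.range i) (r : R) :
    (permutationRestr i hi hinj ≫ permutationIncl i hi).hom (MonoidAlgebra.single x r) = 0 := by
  change (permutationIncl i hi).hom ((permutationRestr i hi hinj).hom _) = _
  rw [permutationRestr_single_of_notMem _ _ _ _ _ hx, map_zero]

/-- The sum of two permutation modules is the permutation module of the disjoint union. -/
lemma nonempty_biprod_iso_ofMulAction_sum (X Y : Type u) [MulAction P X] [MulAction P Y] :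
    Nonempty (Rep.ofMulAction R P (X ⊕ Y) ≅ Rep.ofMulAction R P X ⊞ Rep.ofMulAction R P Y) := by
  let i : X → X ⊕ Y := Sum.inl
  let j : Y → X ⊕ Y := Sum.inr
  have hi : ∀ (g : P) x, i (g • x) = g • i x := fun _ _ => rfl
  have hj : ∀ (g : P) x, j (g • x) = g • j x := fun _ _ => rfl
  have hi' : Function.Injective i := Sum.inl_injective
  have hj' : Function.Injective j := Sum.inr_injective
  let b : BinaryBicone (Rep.ofMulAction R P X) (Rep.ofMulAction R P Y) :=
    { pt := Rep.ofMulAction R P (X ⊕ Y)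
      fst := permutationRestr i hi hi'
      snd := permutationRestr j hj hj'
      inl := permutationIncl i hi
      inr := permutationIncl j hj
      inl_fst := permutationIncl_comp_permutationRestr _ _ _
      inl_snd := permutationIncl_comp_permutationRestr_of_notMem _ _ _ _ _ (by simp [i, j])
      inr_fst := permutationIncl_comp_permutationRestr_of_notMem _ _ _ _ _ (by simp [i, j])
      inr_snd := permutationIncl_comp_permutationRestr _ _ _ }
  refine ⟨biprod.uniqueUpToIso _ _ (b := b) (isBinaryBilimitOfTotal b (permutationHom_ext ?_))⟩
  intro x
  change (permutationRestr (R := R) i hi hi' ≫ permutationIncl i hi).hom _ +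
    (permutationRestr (R := R) j hj hj' ≫ permutationIncl j hj).hom _ = MonoidAlgebra.single x 1
  obtain x | x := x
  · rw [permutationProj_single i hi hi' _ ⟨x, rfl⟩,
      permutationProj_single_of_notMem j hj hj' _ (by simp [j]), add_zero]
  · rw [permutationProj_single j hj hj' _ ⟨x, rfl⟩,
      permutationProj_single_of_notMem i hi hi' _ (by simp [i]), zero_add]

lemma IsPermutationModule.biprod {M N : Rep.{u} R P} (hM : IsPermutationModule M)
    (hN : IsPermutationModule N) : IsPermutationModule (M ⊞ N) := by
  obtain ⟨X, _, _, ⟨e⟩⟩ := hM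
  obtain ⟨Y, _, _, ⟨f⟩⟩ := hN
  obtain ⟨t⟩ := nonempty_biprod_iso_ofMulAction_sum (R := R) (P := P) X Y
  exact ⟨X ⊕ Y, inferInstance, inferInstance, ⟨biprod.mapIso e f ≪≫ t.symm⟩⟩

lemma IsPermutationModule.of_iso {M N : Rep.{u} R P} (e : M ≅ N) (hM : IsPermutationModule M) :
    IsPermutationModule N := by
  obtain ⟨X, _, _, ⟨f⟩⟩ := hM
  exact ⟨X, inferInstance, inferInstance, ⟨e.symm ≪≫ f⟩⟩

lemma isPermutationModule_of_isZero {M : Rep.{u} R P} (hM : IsZero M) : IsPermutationModule M := by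
  let _ : MulAction P PEmpty.{u + 1} :=
    { smul _ x := x, one_smul _ := rfl, mul_smul _ _ _ := rfl }
  refine ⟨PEmpty, inferInstance, inferInstance, ⟨hM.iso ?_⟩⟩
  rw [IsZero.iff_id_eq_zero]
  exact permutationHom_ext fun x => x.elim

variable (R P) in
/-- A permutation module is the sum of the permutation modules of the orbits. -/
lemma exists_sum_orbits_eq_id (X : Type u) [MulAction P X]
    [Fintype (MulAction.orbitRel.Quotient P X)] :
    ∃ (a : ∀ x : MulAction.orbitRel.Quotient P X,
        Rep.ofMulAction R P X ⟶ Rep.ofMulAction R P x.orbit)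
      (b : ∀ x : MulAction.orbitRel.Quotient P X,
        Rep.ofMulAction R P x.orbit ⟶ Rep.ofMulAction R P X), ∑ x, a x ≫ b x = 𝟙 _ := by
  classical
  have hval : ∀ (x : MulAction.orbitRel.Quotient P X) (g : P) (s : x.orbit),
      ((g • s : x.orbit) : X) = g • (s : X) := fun _ _ _ => rfl
  let a : ∀ x : MulAction.orbitRel.Quotient P X,
      Rep.ofMulAction R P X ⟶ Rep.ofMulAction R P x.orbit :=
    fun x => permutationRestr Subtype.val (hval x) Subtype.val_injective
  let b : ∀ x : MulAction.orbitRel.Quotient P X,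
      Rep.ofMulAction R P x.orbit ⟶ Rep.ofMulAction R P X :=
    fun x => permutationIncl Subtype.val (hval x)
  have h1 : ∀ (x : MulAction.orbitRel.Quotient P X) (y : X), y ∈ x.orbit →
      (a x ≫ b x).hom (MonoidAlgebra.single y 1) = MonoidAlgebra.single y 1 := fun x y hy =>
    permutationProj_single Subtype.val (hval x) Subtype.val_injective y ⟨⟨y, hy⟩, rfl⟩ 1
  have h2 : ∀ (x : MulAction.orbitRel.Quotient P X) (y : X), y ∉ x.orbit →
      (a x ≫ b x).hom (MonoidAlgebra.single y 1) = 0 := fun x y hy =>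
    permutationProj_single_of_notMem Subtype.val (hval x) Subtype.val_injective y
      (by rintro ⟨⟨w, hw⟩, rfl⟩; exact hy hw) 1
  clear_value a b
  refine ⟨a, b, permutationHom_ext fun y => ?_⟩
  have hz : ∀ x : MulAction.orbitRel.Quotient P X, y ∈ x.orbit ↔ Quotient.mk'' y = x := fun x =>
    MulAction.orbitRel.Quotient.mem_orbit
  rw [Rep.sum_hom, Representation.IntertwiningMap.sum_apply,
    Finset.sum_eq_single (Quotient.mk'' y : MulAction.orbitRel.Quotient P X)]
  · exact h1 _ y ((hz _).2 rfl)
  · exact fun x _ hx => h2 x y fun hy => hx ((hz x).1 hy).symm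
  · simp

/-- A direct summand with local endomorphism ring of a permutation module of a `p`-group is a
permutation module. -/
lemma isPermutationModule_of_isLocalRing_end {p : ℕ} [Fact p.Prime] [IsDomain R] [IsLocalRing R]
    [CharP (IsLocalRing.ResidueField R) p] (hP : IsPGroup p P) {M : Rep.{u} R P}
    [IsLocalRing (End M)] {X : Type u} [Finite X] [MulAction P X]
    (h : IsDirectSummand M (Rep.ofMulAction R P X)) : IsPermutationModule M := by
  classical
  obtain ⟨r⟩ := h.nonempty_retract
  have := Fintype.ofFinite (MulAction.orbitRel.Quotient P X)
  obtain ⟨a, b, hab⟩ := exists_sum_orbits_eq_id R P X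
  have hsum : ∑ x, (r.i ≫ a x) ≫ b x ≫ r.r = 𝟙 M := by
    have : r.i ≫ (∑ x, a x ≫ b x) ≫ r.r = 𝟙 M := by rw [hab, Category.id_comp, r.retract]
    simpa [Preadditive.comp_sum, Preadditive.sum_comp] using this
  -- Locality of `End M` singles out one orbit whose permutation module has `M` as a retract. That
  -- module has only trivial idempotents, so the nonzero `M` is all of it.
  obtain ⟨x, -, ⟨t⟩⟩ := exists_retract_of_sum_eq_id (X := M) Finset.univ _ _ _ hsum
  have hM : ¬ IsZero M := fun h => by
    have : (1 : End M) = 0 := h.eq_of_src _ _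
    exact one_ne_zero this
  obtain h0 | h1 := permutationHom_eq_zero_or_eq_id hP (t.r ≫ t.i) (by simp)
  · refine (hM ?_).elim
    rw [IsZero.iff_id_eq_zero]
    calc 𝟙 M = t.i ≫ (t.r ≫ t.i) ≫ t.r := by simp
      _ = 0 := by rw [h0, zero_comp, comp_zero]
  · exact ⟨x.orbit, inferInstance, inferInstance, ⟨⟨t.i, t.r, t.retract, h1⟩⟩⟩

end PermutationModules

/-! ### Minimal numbers of generators as a measure for decompositions -/

section Rank

lemma finite_of_isDirectSummand {R : Type u} [CommRing R] {Γ : Type u} [Group Γ]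
    {M N : Rep.{u} R Γ} (h : IsDirectSummand M N)
    [Module.Finite R N] : Module.Finite R M := by
  obtain ⟨r⟩ := h.nonempty_retract
  exact Module.Finite.of_surjective r.r.hom.toLinearMap fun m =>
    ⟨r.i.hom m, congrArg (fun f : M ⟶ M => f.hom m) r.retract⟩

open IsLocalRing

variable {R : Type u} [CommRing R] [IsLocalRing R] {Γ : Type u} [Group Γ]

variable (R) in
/-- The minimal number of generators of a finitely generated module over a local ring. -/
def residueRank (M : Type u) [AddCommGroup M] [Module R M] : ℕ :=
  Module.finrank (ResidueField R) (ResidueField R ⊗[R] M)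

lemma residueRank_eq_add {M Y Z : Type u} [AddCommGroup M] [Module R M] [Module.Finite R M]
    [AddCommGroup Y] [Module R Y] [AddCommGroup Z] [Module R Z] (a : Y →ₗ[R] M) (b : Z →ₗ[R] M)
    (p : M →ₗ[R] Y) (q : M →ₗ[R] Z) (hpa : ∀ y, p (a y) = y) (hqb : ∀ z, q (b z) = z)
    (hpb : ∀ z, p (b z) = 0) (hqa : ∀ y, q (a y) = 0) (h : ∀ m, a (p m) + b (q m) = m) :
    residueRank R M = residueRank R Y + residueRank R Z := by
  let t : M ≃ₗ[R] Y × Z :=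
    { p.prod q with
      invFun := a.coprod b
      left_inv := h
      right_inv := fun ⟨y, z⟩ => by simp [hpa, hqb, hpb, hqa] }
  have : Module.Finite R (Y × Z) := Module.Finite.equiv t
  have : Module.Finite R Y := Module.Finite.of_surjective (LinearMap.fst R Y Z)
    LinearMap.fst_surjective
  have : Module.Finite R Z := Module.Finite.of_surjective (LinearMap.snd R Y Z)
    LinearMap.snd_surjective
  unfold residueRank
  rw [← Module.finrank_prod,
    ← (TensorProduct.prodRight R (ResidueField R) (ResidueField R) Y Z).finrank_eq]
  exact (t.baseChange R (ResidueField R) M (Y × Z)).finrank_eq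

/-- Nakayama's lemma. With additivity, it makes the rank drop strictly whenever a module splits into
two nonzero summands. -/
lemma residueRank_pos {M : Type u} [AddCommGroup M] [Module R M] [Module.Finite R M]
    [Nontrivial M] : 0 < residueRank R M := by
  by_contra h
  have h1 : residueRank R M = 0 := by lia
  rw [residueRank, Module.finrank_eq_zero_iff_of_free, IsLocalRing.subsingleton_tensorProduct] at h1
  exact not_subsingleton M h1

lemma residueRank_eq_of_iso_biprod {M Y Z : Rep.{u} R Γ} [Module.Finite R M] (e : M ≅ Y ⊞ Z) :
    residueRank R M = residueRank R Y + residueRank R Z := by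
  have key : ∀ {U V W : Rep.{u} R Γ} {f : U ⟶ V} {g : V ⟶ W} {k : U ⟶ W}, f ≫ g = k →
      ∀ x, g.hom (f.hom x) = k.hom x := by
    rintro U V W f g _ rfl x
    rfl
  have h : (e.hom ≫ biprod.fst) ≫ biprod.inl ≫ e.inv + (e.hom ≫ biprod.snd) ≫ biprod.inr ≫ e.inv =
      𝟙 M := by
    have : e.hom ≫ (biprod.fst ≫ biprod.inl + biprod.snd ≫ biprod.inr) ≫ e.inv = 𝟙 M := by simp
    simpa only [Preadditive.add_comp, Preadditive.comp_add, Category.assoc] using this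
  exact residueRank_eq_add (biprod.inl ≫ e.inv).hom.toLinearMap
    (biprod.inr ≫ e.inv).hom.toLinearMap (e.hom ≫ biprod.fst).hom.toLinearMap
    (e.hom ≫ biprod.snd).hom.toLinearMap (key (k := 𝟙 Y) (by simp)) (key (k := 𝟙 Z) (by simp))
    (key (k := 0) (by simp)) (key (k := 0) (by simp))
    fun m => congrArg (fun f : M ⟶ M => f.hom m) h

instance finite_end [IsNoetherianRing R] (M : Rep.{u} R Γ) [Module.Finite R M] :
    Module.Finite R (End M) := by
  let f : End M →ₗ[R] (M →ₗ[R] M) :=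
    { toFun g := g.hom.toLinearMap
      map_add' _ _ := rfl
      map_smul' _ _ := rfl }
  have : Module.Finite R (M →ₗ[R] M) := inferInstance
  exact Module.Finite.of_injective f fun g g' h =>
    Rep.hom_ext (Representation.IntertwiningMap.toLinearMap_injective _ _ h)

/-- A finitely generated direct summand of a permutation module of a `p`-group is a permutation
module. -/
theorem IsPermutationModule.of_isDirectSummand {p : ℕ} [Fact p.Prime] [IsDomain R]
    [IsNoetherianRing R] [IsAdicComplete (maximalIdeal R) R] [CharP (ResidueField R) p]
    (hP : IsPGroup p Γ) {M N : Rep.{u} R Γ} [hM : Module.Finite R M] (hN : IsPermutationModule N)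
    (h : IsDirectSummand M N) : IsPermutationModule M := by
  obtain ⟨X, _, _, ⟨e⟩⟩ := hN
  replace h : IsDirectSummand M (Rep.ofMulAction R Γ X) :=
    h.trans (.of_retract (Retract.ofIso e))
  clear e
  -- Split off summands until they are indecomposable. Indecomposable ones have local endomorphism
  -- rings and are covered by the previous result; otherwise both summands have smaller rank, and a
  -- sum of permutation modules is one.
  induction hn : residueRank R M using Nat.strong_induction_on generalizing M with
  | _ n ih =>
  subst hn
  by_cases hM0 : IsZero M
  · exact isPermutationModule_of_isZero hM0
  by_cases hMi : Indecomposable M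
  · have := isLocalRing_end_of_indecomposable (R := R) hMi
    exact isPermutationModule_of_isLocalRing_end hP h
  · simp only [Indecomposable, not_and, not_forall, not_or] at hMi
    obtain ⟨Y, Z, t, hY, hZ⟩ := hMi hM0
    have := finite_of_isDirectSummand (.left t)
    have := finite_of_isDirectSummand (.right t)
    rw [Rep.isZero_iff, not_subsingleton_iff_nontrivial] at hY hZ
    have h1 := residueRank_eq_of_iso_biprod t
    have h2 : 0 < residueRank R Y := residueRank_pos
    have h3 : 0 < residueRank R Z := residueRank_pos
    have hY := ih _ (by lia) ((IsDirectSummand.left t).trans h) rfl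
    have hZ := ih _ (by lia) ((IsDirectSummand.right t).trans h) rfl
    exact (hY.biprod hZ).of_iso t.symm

end Rank

/-! ### Associativity of the tensor product of bimodules -/

section Associativity

variable {R : Type u} [CommRing R] {G H K L : Type u} [Group G] [Group H] [Group K] [Group L]

/-- Pure tensors in the tensor product of bimodules. -/
def tensorMk (M : Rep.{u} R (G × H)) (N : Rep.{u} R (H × K)) :
    M →ₗ[R] N →ₗ[R] tensorObj M N :=
  (TensorProduct.mk R M N).compr₂ (Representation.Coinvariants.mk (balancedRep M N))

/-- The defining relation of the coinvariants. Since `(1, h)` acts on `M` as `m ↦ m h⁻¹`, it reads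
`m h⁻¹ ⊗ h n = m ⊗ n`. -/
lemma tensorMk_balanced (M : Rep.{u} R (G × H)) (N : Rep.{u} R (H × K)) (h : H) (m : M) (n : N) :
    tensorMk M N (M.ρ (1, h) m) (N.ρ (h, 1) n) = tensorMk M N m n :=
  Representation.Coinvariants.mk_self_apply (balancedRep M N) h (m ⊗ₜ n)

lemma tensorObj_ρ (M : Rep.{u} R (G × H)) (N : Rep.{u} R (H × K)) (x : G × K) (m : M) (n : N) :
    (tensorObj M N).ρ x (tensorMk M N m n) = tensorMk M N (M.ρ (x.1, 1) m) (N.ρ (1, x.2) n) := rfl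

/-- The linear map on the tensor product of bimodules induced by a balanced bilinear map. -/
def tensorLiftLinear {M : Rep.{u} R (G × H)} {N : Rep.{u} R (H × K)} {W : Type u} [AddCommGroup W]
    [Module R W] (f : M →ₗ[R] N →ₗ[R] W)
    (hf : ∀ (h : H) m n, f (M.ρ (1, h) m) (N.ρ (h, 1) n) = f m n) : tensorObj M N →ₗ[R] W :=
  Representation.Coinvariants.lift (balancedRep M N) (TensorProduct.lift f) fun h => by
    ext m n
    exact hf h m n

lemma tensorLiftLinear_mk {M : Rep.{u} R (G × H)} {N : Rep.{u} R (H × K)} {W : Type u}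
    [AddCommGroup W] [Module R W] (f : M →ₗ[R] N →ₗ[R] W)
    (hf : ∀ (h : H) m n, f (M.ρ (1, h) m) (N.ρ (h, 1) n) = f m n) (m : M) (n : N) :
    tensorLiftLinear f hf (tensorMk M N m n) = f m n := rfl

lemma tensorLinear_ext {M : Rep.{u} R (G × H)} {N : Rep.{u} R (H × K)} {W : Type u}
    [AddCommGroup W] [Module R W] {f g : tensorObj M N →ₗ[R] W}
    (h : ∀ m n, f (tensorMk M N m n) = g (tensorMk M N m n)) : f = g := by
  apply Representation.Coinvariants.hom_ext
  apply TensorProduct.ext'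
  exact h

lemma tensorHom_ext {M : Rep.{u} R (G × H)} {N : Rep.{u} R (H × K)} {W : Rep.{u} R (G × K)}
    {f g : tensorObj M N ⟶ W}
    (h : ∀ m n, f.hom (tensorMk M N m n) = g.hom (tensorMk M N m n)) : f = g :=
  tensorObj_hom_ext h

lemma tensorObj_induction {M : Rep.{u} R (G × H)} {N : Rep.{u} R (H × K)}
    {p : tensorObj M N → Prop} (zero : p 0) (add : ∀ x y, p x → p y → p (x + y))
    (mk : ∀ m n, p (tensorMk M N m n)) (t : tensorObj M N) : p t := by
  induction t using Representation.Coinvariants.induction_on with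
  | _ t =>
  induction t using TensorProduct.induction_on with
  | zero =>
    rw [map_zero]
    exact zero
  | add x y hx hy =>
    rw [map_add]
    exact add _ _ hx hy
  | tmul m n => exact mk m n

/-- The universal property of the tensor product of bimodules. -/
def tensorLift {M : Rep.{u} R (G × H)} {N : Rep.{u} R (H × K)} {W : Rep.{u} R (G × K)}
    (f : M →ₗ[R] N →ₗ[R] W)
    (hf : ∀ (h : H) m n, f (M.ρ (1, h) m) (N.ρ (h, 1) n) = f m n)
    (hf' : ∀ (g : G) (k : K) m n, f (M.ρ (g, 1) m) (N.ρ (1, k) n) = W.ρ (g, k) (f m n)) :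
    tensorObj M N ⟶ W :=
  Rep.ofHom ⟨tensorLiftLinear f hf, fun x => tensorLinear_ext fun m n => hf' x.1 x.2 m n⟩

lemma ρ_one_one (M : Rep.{u} R (G × H)) (m : M) : M.ρ (1, 1) m = m := by
  rw [← Prod.one_eq_mk, map_one, Module.End.one_apply]

/-- The trilinear map inducing the associativity map. -/
def tensorAssocAux (M : Rep.{u} R (G × H)) (N : Rep.{u} R (H × K)) (Q : Rep.{u} R (K × L)) :
    M →ₗ[R] N →ₗ[R] Q →ₗ[R] tensorObj M (tensorObj N Q) where
  toFun m := (tensorMk N Q).compr₂ (tensorMk M (tensorObj N Q) m)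
  map_add' m m' := by ext n q; simp
  map_smul' r m := by ext n q; simp

lemma tensorAssocAux_apply (M : Rep.{u} R (G × H)) (N : Rep.{u} R (H × K)) (Q : Rep.{u} R (K × L))
    (m : M) (n : N) (q : Q) :
    tensorAssocAux M N Q m n q = tensorMk M (tensorObj N Q) m (tensorMk N Q n q) := rfl

/-- The associativity map for tensor products of bimodules. -/
def tensorAssocHom (M : Rep.{u} R (G × H)) (N : Rep.{u} R (H × K)) (Q : Rep.{u} R (K × L)) :
    tensorObj (tensorObj M N) Q ⟶ tensorObj M (tensorObj N Q) :=
  tensorLift (tensorLiftLinear (tensorAssocAux M N Q) fun h m n => by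
      ext q
      rw [tensorAssocAux_apply, tensorAssocAux_apply,
        ← tensorMk_balanced M (tensorObj N Q) h m, tensorObj_ρ, ρ_one_one])
    (fun k t q => by
      induction t using tensorObj_induction with
      | zero => simp only [map_zero, LinearMap.zero_apply]
      | add x y hx hy => simp only [map_add, LinearMap.add_apply, hx, hy]
      | mk m n =>
        rw [tensorObj_ρ, tensorLiftLinear_mk, tensorLiftLinear_mk, tensorAssocAux_apply,
          tensorAssocAux_apply, tensorMk_balanced, ρ_one_one])
    (fun g l t q => by
      induction t using tensorObj_induction with
      | zero => simp only [map_zero, LinearMap.zero_apply]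
      | add x y hx hy => simp only [map_add, LinearMap.add_apply, hx, hy]
      | mk m n =>
        rw [tensorObj_ρ, tensorLiftLinear_mk, tensorLiftLinear_mk, tensorAssocAux_apply,
          tensorAssocAux_apply, tensorObj_ρ, tensorObj_ρ, ρ_one_one])

/-- The inverse associativity map for tensor products of bimodules. -/
def tensorAssocInv (M : Rep.{u} R (G × H)) (N : Rep.{u} R (H × K)) (Q : Rep.{u} R (K × L)) :
    tensorObj M (tensorObj N Q) ⟶ tensorObj (tensorObj M N) Q :=
  have h1 : ∀ (m : M) (k : K) (n : N) (q : Q),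
      (tensorMk (tensorObj M N) Q ∘ₗ tensorMk M N m) (N.ρ (1, k) n) (Q.ρ (k, 1) q) =
        (tensorMk (tensorObj M N) Q ∘ₗ tensorMk M N m) n q := fun m k n q => by
    rw [LinearMap.comp_apply, LinearMap.comp_apply,
      ← tensorMk_balanced (tensorObj M N) Q k (tensorMk M N m n), tensorObj_ρ, ρ_one_one]
  tensorLift
    { toFun m := tensorLiftLinear (tensorMk (tensorObj M N) Q ∘ₗ tensorMk M N m) (h1 m)
      map_add' m m' := tensorLinear_ext fun n q => by
        rw [LinearMap.add_apply, tensorLiftLinear_mk, tensorLiftLinear_mk, tensorLiftLinear_mk]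
        simp
      map_smul' r m := tensorLinear_ext fun n q => by
        rw [LinearMap.smul_apply, tensorLiftLinear_mk, tensorLiftLinear_mk]
        simp }
    (fun h m t => by
      simp only [LinearMap.coe_mk, AddHom.coe_mk]
      induction t using tensorObj_induction with
      | zero => simp only [map_zero]
      | add x y hx hy => simp only [map_add, hx, hy]
      | mk n q =>
        rw [tensorObj_ρ, tensorLiftLinear_mk, tensorLiftLinear_mk, LinearMap.comp_apply,
          LinearMap.comp_apply, tensorMk_balanced, ρ_one_one])
    (fun g l m t => by
      simp only [LinearMap.coe_mk, AddHom.coe_mk]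
      induction t using tensorObj_induction with
      | zero => simp only [map_zero]
      | add x y hx hy => simp only [map_add, hx, hy]
      | mk n q =>
        rw [tensorObj_ρ, tensorLiftLinear_mk, tensorLiftLinear_mk, LinearMap.comp_apply,
          LinearMap.comp_apply, tensorObj_ρ, tensorObj_ρ, ρ_one_one])

lemma tensorLeft_ext {M : Rep.{u} R (G × H)} {N : Rep.{u} R (H × K)} {Q : Rep.{u} R (K × L)}
    {W : Rep.{u} R (G × L)} {f g : tensorObj (tensorObj M N) Q ⟶ W}
    (h : ∀ m n q, f.hom (tensorMk (tensorObj M N) Q (tensorMk M N m n) q) =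
      g.hom (tensorMk (tensorObj M N) Q (tensorMk M N m n) q)) : f = g :=
  tensorHom_ext fun t q => by
    induction t using tensorObj_induction with
    | zero => simp only [map_zero, LinearMap.zero_apply]
    | add x y hx hy => simp only [map_add, LinearMap.add_apply, hx, hy]
    | mk m n => exact h m n q

lemma tensorRight_ext {M : Rep.{u} R (G × H)} {N : Rep.{u} R (H × K)} {Q : Rep.{u} R (K × L)}
    {W : Rep.{u} R (G × L)} {f g : tensorObj M (tensorObj N Q) ⟶ W}
    (h : ∀ m n q, f.hom (tensorMk M (tensorObj N Q) m (tensorMk N Q n q)) =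
      g.hom (tensorMk M (tensorObj N Q) m (tensorMk N Q n q))) : f = g :=
  tensorHom_ext fun m t => by
    induction t using tensorObj_induction with
    | zero => simp only [map_zero]
    | add x y hx hy => simp only [map_add, hx, hy]
    | mk n q => exact h m n q

/-- The associativity isomorphism for tensor products of bimodules. -/
def tensorAssoc (M : Rep.{u} R (G × H)) (N : Rep.{u} R (H × K)) (Q : Rep.{u} R (K × L)) :
    tensorObj (tensorObj M N) Q ≅ tensorObj M (tensorObj N Q) where
  hom := tensorAssocHom M N Q
  inv := tensorAssocInv M N Q
  hom_inv_id := tensorLeft_ext fun _ _ _ => rfl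
  inv_hom_id := tensorRight_ext fun _ _ _ => rfl

variable (R G H K L) in
/-- The natural associativity isomorphism for tensor products of bimodules. -/
def tensorAssociator :
    bifunctorComp₁₂ (tensorFunctor R G H K) (tensorFunctor R G K L) ≅
      bifunctorComp₂₃ (tensorFunctor R G H L) (tensorFunctor R H K L) :=
  NatIso.ofComponents (fun M => NatIso.ofComponents (fun N => NatIso.ofComponents
    (fun Q => tensorAssoc M N Q)
    (fun _ => tensorLeft_ext fun _ _ _ => rfl))
    (fun _ => by
      ext Q : 2
      exact tensorLeft_ext fun _ _ _ => rfl))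
    (fun _ => by
      ext N Q : 4
      exact tensorLeft_ext fun _ _ _ => rfl)

end Associativity

/-! ### Tensor–hom adjunctions, and associativity for complexes -/

section Adjunctions

variable {R : Type u} [CommRing R] {G H K : Type u} [Group G] [Group H] [Group K]

lemma ρ_comm_left_right (M : Rep.{u} R (G × H)) (g : G) (h : H) (m : M) :
    M.ρ (g, 1) (M.ρ (1, h) m) = M.ρ (1, h) (M.ρ (g, 1) m) := by
  rw [← Module.End.mul_apply, ← Module.End.mul_apply, ← map_mul, ← map_mul]
  simp

lemma ρ_eq_left_right (M : Rep.{u} R (G × H)) (g : G) (h : H) (m : M) :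
    M.ρ (g, h) m = M.ρ (g, 1) (M.ρ (1, h) m) := by
  rw [← Module.End.mul_apply, ← map_mul]
  simp

lemma ρ_right_inv (M : Rep.{u} R (G × H)) (h : H) (m : M) :
    M.ρ (1, h⁻¹) (M.ρ (1, h) m) = m := by
  rw [← Module.End.mul_apply, ← map_mul]
  simp [← Prod.one_eq_mk]

lemma ρ_left_inv (M : Rep.{u} R (G × H)) (g : G) (m : M) :
    M.ρ (g⁻¹, 1) (M.ρ (g, 1) m) = m := by
  rw [← Module.End.mul_apply, ← map_mul]
  simp [← Prod.one_eq_mk]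

/-- The homomorphisms of left modules between two bimodules. -/
def leftHom (M : Rep.{u} R (G × H)) (W : Rep.{u} R (G × K)) : Submodule R (M →ₗ[R] W) where
  carrier := { f | ∀ g m, f (M.ρ (g, 1) m) = W.ρ (g, 1) (f m) }
  zero_mem' g m := by simp
  add_mem' {f f'} hf hf' g m := by simp [hf g m, hf' g m]
  smul_mem' r f hf g m := by simp [hf g m]

/-- The bimodule of homomorphisms of left modules. -/
def leftHomObj (M : Rep.{u} R (G × H)) (W : Rep.{u} R (G × K)) : Rep.{u} R (H × K) :=
  Rep.of (X := leftHom M W)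
    { toFun x :=
        { toFun f := ⟨W.ρ (1, x.2) ∘ₗ f.1 ∘ₗ M.ρ (1, x.1⁻¹), fun g m => by
            simp only [LinearMap.comp_apply]
            rw [← ρ_comm_left_right, f.2, ← ρ_comm_left_right]⟩
          map_add' f f' := by ext; simp
          map_smul' r f := by ext; simp }
      map_one' := by
        ext f m
        simp [← Prod.one_eq_mk]
      map_mul' x y := by
        ext f m
        have h1 : ((1, (x.1 * y.1)⁻¹) : G × H) = (1, y.1⁻¹) * (1, x.1⁻¹) := by simp
        have h2 : ((1, x.2 * y.2) : G × K) = (1, x.2) * (1, y.2) := by simp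
        change W.ρ (1, x.2 * y.2) (f.1 (M.ρ (1, (x.1 * y.1)⁻¹) m)) =
          W.ρ (1, x.2) (W.ρ (1, y.2) (f.1 (M.ρ (1, y.1⁻¹) (M.ρ (1, x.1⁻¹) m))))
        rw [h1, h2, map_mul, map_mul]
        rfl }

lemma leftHomObj_ρ (M : Rep.{u} R (G × H)) (W : Rep.{u} R (G × K)) (x : H × K)
    (f : leftHomObj M W) (m : M) :
    ((leftHomObj M W).ρ x f).1 m = W.ρ (1, x.2) (f.1 (M.ρ (1, x.1⁻¹) m)) := rfl

/-- The adjunction between tensor products and homomorphisms of left modules. -/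
def tensorLeftHomEquiv (M : Rep.{u} R (G × H)) (N : Rep.{u} R (H × K)) (W : Rep.{u} R (G × K)) :
    (tensorObj M N ⟶ W) ≃ (N ⟶ leftHomObj M W) where
  toFun f := Rep.ofHom (σ := (leftHomObj M W).ρ)
    ⟨{ toFun n := ⟨f.hom.toLinearMap ∘ₗ (tensorMk M N).flip n, fun g m => by
        have h := Rep.hom_comm_apply f (g, 1) (tensorMk M N m n)
        rw [tensorObj_ρ, ρ_one_one] at h
        exact h⟩
       map_add' n n' := Subtype.ext (LinearMap.ext fun m => by simp; rfl)
       map_smul' r n := Subtype.ext (LinearMap.ext fun m => by simp; rfl) }, fun x => by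
      refine LinearMap.ext fun n => Subtype.ext (LinearMap.ext fun m => ?_)
      -- Only the `K`-part of the equivariance of `f` is used. The `H`-part comes from starting with
      -- `x.1⁻¹` acting on `m` and moving `x.1` across the tensor sign.
      have h := Rep.hom_comm_apply f (1, x.2) (tensorMk M N (M.ρ (1, x.1⁻¹) m) n)
      rw [tensorObj_ρ, ρ_one_one, ← tensorMk_balanced M N x.1, ← ρ_eq_left_right] at h
      have h2 := ρ_right_inv M x.1⁻¹ m
      rw [inv_inv] at h2
      rw [h2] at h
      exact h⟩
  invFun f := tensorLift (LinearMap.flip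
      { toFun n := (f.hom n).1
        map_add' n n' := by rw [map_add]; rfl
        map_smul' r n := by rw [map_smul]; rfl })
    (fun h m n => by
      change (f.hom (N.ρ (h, 1) n)).1 (M.ρ (1, h) m) = (f.hom n).1 m
      rw [Rep.hom_comm_apply, leftHomObj_ρ, ρ_right_inv, ρ_one_one])
    (fun g k m n => by
      change (f.hom (N.ρ (1, k) n)).1 (M.ρ (g, 1) m) = W.ρ (g, k) ((f.hom n).1 m)
      rw [Rep.hom_comm_apply, leftHomObj_ρ, inv_one, ρ_one_one, (f.hom n).2,
        ← ρ_comm_left_right, ← ρ_eq_left_right])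
  left_inv f := tensorHom_ext fun _ _ => rfl
  right_inv f := rfl

/-- Left adjoints preserve coproducts. Tensoring therefore commutes with the direct sums forming a
total complex, as associativity for complexes requires. -/
instance tensorFunctor_obj_isLeftAdjoint (M : Rep.{u} R (G × H)) :
    ((tensorFunctor R G H K).obj M).IsLeftAdjoint :=
  (Adjunction.adjunctionOfEquivRight (F := (tensorFunctor R G H K).obj M)
    (fun N W => tensorLeftHomEquiv M N W) (fun _ _ _ _ _ => rfl)).isLeftAdjoint

/-- The homomorphisms of right modules between two bimodules. -/
def rightHom (N : Rep.{u} R (H × K)) (W : Rep.{u} R (G × K)) : Submodule R (N →ₗ[R] W) where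
  carrier := { f | ∀ k n, f (N.ρ (1, k) n) = W.ρ (1, k) (f n) }
  zero_mem' g m := by simp
  add_mem' {f f'} hf hf' g m := by simp [hf g m, hf' g m]
  smul_mem' r f hf g m := by simp [hf g m]

/-- The bimodule of homomorphisms of right modules. -/
def rightHomObj (N : Rep.{u} R (H × K)) (W : Rep.{u} R (G × K)) : Rep.{u} R (G × H) :=
  Rep.of (X := rightHom N W)
    { toFun x :=
        { toFun f := ⟨W.ρ (x.1, 1) ∘ₗ f.1 ∘ₗ N.ρ (x.2⁻¹, 1), fun g m => by
            simp only [LinearMap.comp_apply]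
            rw [ρ_comm_left_right, f.2, ρ_comm_left_right]⟩
          map_add' f f' := by ext; simp
          map_smul' r f := by ext; simp }
      map_one' := by
        ext f m
        simp [← Prod.one_eq_mk]
      map_mul' x y := by
        ext f m
        have h1 : (((x.2 * y.2)⁻¹, 1) : H × K) = (y.2⁻¹, 1) * (x.2⁻¹, 1) := by simp
        have h2 : ((x.1 * y.1, 1) : G × K) = (x.1, 1) * (y.1, 1) := by simp
        change W.ρ (x.1 * y.1, 1) (f.1 (N.ρ ((x.2 * y.2)⁻¹, 1) m)) =
          W.ρ (x.1, 1) (W.ρ (y.1, 1) (f.1 (N.ρ (y.2⁻¹, 1) (N.ρ (x.2⁻¹, 1) m))))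
        rw [h1, h2, map_mul, map_mul]
        rfl }

lemma rightHomObj_ρ (N : Rep.{u} R (H × K)) (W : Rep.{u} R (G × K)) (x : G × H)
    (f : rightHomObj N W) (n : N) :
    ((rightHomObj N W).ρ x f).1 n = W.ρ (x.1, 1) (f.1 (N.ρ (x.2⁻¹, 1) n)) := rfl

/-- The adjunction between tensor products and homomorphisms of right modules. -/
def tensorRightHomEquiv (M : Rep.{u} R (G × H)) (N : Rep.{u} R (H × K)) (W : Rep.{u} R (G × K)) :
    (tensorObj M N ⟶ W) ≃ (M ⟶ rightHomObj N W) where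
  toFun f := Rep.ofHom (σ := (rightHomObj N W).ρ)
    ⟨{ toFun m := ⟨f.hom.toLinearMap ∘ₗ tensorMk M N m, fun k n => by
        have h := Rep.hom_comm_apply f (1, k) (tensorMk M N m n)
        rw [tensorObj_ρ, ρ_one_one] at h
        exact h⟩
       map_add' n n' := Subtype.ext (LinearMap.ext fun m => by simp; rfl)
       map_smul' r n := Subtype.ext (LinearMap.ext fun m => by simp; rfl) }, fun x => by
      refine LinearMap.ext fun m => Subtype.ext (LinearMap.ext fun n => ?_)
      have h := Rep.hom_comm_apply f (x.1, 1) (tensorMk M N m (N.ρ (x.2⁻¹, 1) n))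
      have h2 := ρ_left_inv N x.2⁻¹ n
      rw [inv_inv] at h2
      rw [tensorObj_ρ, ρ_one_one, ← tensorMk_balanced M N x.2, h2, ← ρ_comm_left_right,
        ← ρ_eq_left_right] at h
      exact h⟩
  invFun f := tensorLift
      { toFun m := (f.hom m).1
        map_add' n n' := by rw [map_add]; rfl
        map_smul' r n := by rw [map_smul]; rfl }
    (fun h m n => by
      change (f.hom (M.ρ (1, h) m)).1 (N.ρ (h, 1) n) = (f.hom m).1 n
      rw [Rep.hom_comm_apply, rightHomObj_ρ, ρ_left_inv, ρ_one_one])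
    (fun g k m n => by
      change (f.hom (M.ρ (g, 1) m)).1 (N.ρ (1, k) n) = W.ρ (g, k) ((f.hom m).1 n)
      rw [Rep.hom_comm_apply, rightHomObj_ρ, inv_one, ρ_one_one, (f.hom m).2,
        ← ρ_eq_left_right])
  left_inv f := tensorHom_ext fun _ _ => rfl
  right_inv f := rfl

/-- The counterpart in the other variable, for total complexes in the left factor. -/
instance tensorFunctor_flip_obj_isLeftAdjoint (N : Rep.{u} R (H × K)) :
    ((tensorFunctor R G H K).flip.obj N).IsLeftAdjoint :=
  (Adjunction.adjunctionOfEquivRight (F := (tensorFunctor R G H K).flip.obj N)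
    (fun M W => tensorRightHomEquiv M N W) (fun _ _ _ _ _ => rfl)).isLeftAdjoint

/-- The associativity isomorphism for tensor products of complexes of bimodules. -/
def tensorComplexAssoc {L : Type u} [Group L] (C : ChainComplex (Rep.{u} R (G × H)) ℤ)
    (D : ChainComplex (Rep.{u} R (H × K)) ℤ) (E : ChainComplex (Rep.{u} R (K × L)) ℤ) :
    tensorComplex (tensorComplex C D) E ≅ tensorComplex C (tensorComplex D E) :=
  HomologicalComplex.mapBifunctorAssociator (tensorAssociator R G H K L) C D E _ _ _

end Adjunctions

/-! ### Contractible complexes and homotopy equivalences -/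

section Homotopies

variable {𝓒 : Type*} [Category 𝓒] [Preadditive 𝓒]

/-- Up to homotopy the identity of `X` factors through the null-homotopic identity of `Y`. Asking
for a retraction only up to homotopy covers homotopy equivalences and strict retracts alike. -/
lemma Contractible.of_homotopy {X Y : ChainComplex 𝓒 ℤ} (hY : Contractible Y) (i : X ⟶ Y)
    (r : Y ⟶ X) (h : Homotopy (i ≫ r) (𝟙 X)) : Contractible X := by
  obtain ⟨c⟩ := hY
  have h1 : Homotopy (i ≫ 𝟙 Y ≫ r) (i ≫ 0 ≫ r) := (c.compRight r).compLeft i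
  exact ⟨h.symm.trans ((Homotopy.ofEq (by simp)).trans (h1.trans (Homotopy.ofEq (by simp))))⟩

lemma Contractible.of_homotopyEquiv {X Y : ChainComplex 𝓒 ℤ} (hY : Contractible Y)
    (e : HomotopyEquiv X Y) : Contractible X :=
  hY.of_homotopy e.hom e.inv e.homotopyHomInvId

lemma Contractible.of_retract {X Y : ChainComplex 𝓒 ℤ} (hY : Contractible Y) (r : Retract X Y) :
    Contractible X :=
  hY.of_homotopy r.i r.r (Homotopy.ofEq r.retract)

lemma contractible_of_isZero {X : ChainComplex 𝓒 ℤ} (h : IsZero X) : Contractible X :=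
  ⟨Homotopy.ofEq (h.eq_of_src _ _)⟩

/-- The image of a homotopy equivalence under a functor that preserves homotopies. -/
def mapHomotopyEquiv {𝓓 : Type*} [Category 𝓓] [Preadditive 𝓓]
    (F : ChainComplex 𝓒 ℤ ⥤ ChainComplex 𝓓 ℤ)
    (hF : ∀ {X Y : ChainComplex 𝓒 ℤ} {f g : X ⟶ Y}, Homotopy f g → Homotopy (F.map f) (F.map g))
    {X Y : ChainComplex 𝓒 ℤ} (e : HomotopyEquiv X Y) : HomotopyEquiv (F.obj X) (F.obj Y) where
  hom := F.map e.hom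
  inv := F.map e.inv
  homotopyHomInvId := (Homotopy.ofEq (by simp)).trans
    ((hF e.homotopyHomInvId).trans (Homotopy.ofEq (by simp)))
  homotopyInvHomId := (Homotopy.ofEq (by simp)).trans
    ((hF e.homotopyInvHomId).trans (Homotopy.ofEq (by simp)))

end Homotopies

/-! ### Tensor products of complexes up to homotopy -/

section Tensor

variable {R : Type u} [CommRing R] {G H K : Type u} [Group G] [Group H] [Group K]

variable (K) in
/-- The functor `C ⊗ -` on chain complexes of bimodules. -/
def tensorComplexLeft (C : ChainComplex (Rep.{u} R (G × H)) ℤ) :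
    ChainComplex (Rep.{u} R (H × K)) ℤ ⥤ ChainComplex (Rep.{u} R (G × K)) ℤ :=
  ((tensorFunctor R G H K).map₂HomologicalComplex (ComplexShape.down ℤ) (ComplexShape.down ℤ)
    (ComplexShape.down ℤ)).obj C

variable (G) in
/-- The functor `- ⊗ D` on chain complexes of bimodules. -/
def tensorComplexRight (D : ChainComplex (Rep.{u} R (H × K)) ℤ) :
    ChainComplex (Rep.{u} R (G × H)) ℤ ⥤ ChainComplex (Rep.{u} R (G × K)) ℤ :=
  ((tensorFunctor R G H K).map₂HomologicalComplex (ComplexShape.down ℤ) (ComplexShape.down ℤ)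
    (ComplexShape.down ℤ)).flip.obj D

/-- The functor `C ⊗ -` preserves homotopies. -/
def tensorComplexLeftHomotopy (C : ChainComplex (Rep.{u} R (G × H)) ℤ)
    {D D' : ChainComplex (Rep.{u} R (H × K)) ℤ} {f g : D ⟶ D'} (h : Homotopy f g) :
    Homotopy ((tensorComplexLeft K C).map f) ((tensorComplexLeft K C).map g) :=
  HomologicalComplex.mapBifunctorMapHomotopy₂ (𝟙 C) h (tensorFunctor R G H K) (ComplexShape.down ℤ)

/-- The functor `- ⊗ D` preserves homotopies. -/
def tensorComplexRightHomotopy (D : ChainComplex (Rep.{u} R (H × K)) ℤ)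
    {C C' : ChainComplex (Rep.{u} R (G × H)) ℤ} {f g : C ⟶ C'} (h : Homotopy f g) :
    Homotopy ((tensorComplexRight G D).map f) ((tensorComplexRight G D).map g) :=
  HomologicalComplex.mapBifunctorMapHomotopy₁ h (𝟙 D) (tensorFunctor R G H K) (ComplexShape.down ℤ)

/-- The tensor product of homotopy equivalences. -/
def tensorHomotopyEquiv {C C' : ChainComplex (Rep.{u} R (G × H)) ℤ}
    {D D' : ChainComplex (Rep.{u} R (H × K)) ℤ} (e : HomotopyEquiv C C')
    (e' : HomotopyEquiv D D') : HomotopyEquiv (tensorComplex C D) (tensorComplex C' D') :=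
  (mapHomotopyEquiv (tensorComplexRight G D) (tensorComplexRightHomotopy D) e).trans
    (mapHomotopyEquiv (tensorComplexLeft K C') (tensorComplexLeftHomotopy C') e')

/-- Checked on each summand `Cᵢ ⊗ Dⱼ`. It is needed to carry null-homotopies through `C ⊗ -`. -/
lemma tensorComplexLeft_map_zero (C : ChainComplex (Rep.{u} R (G × H)) ℤ)
    (D D' : ChainComplex (Rep.{u} R (H × K)) ℤ) :
    (tensorComplexLeft K C).map (0 : D ⟶ D') = 0 := by
  ext n : 1
  apply HomologicalComplex.mapBifunctor.hom_ext
  intro i j hij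
  refine (HomologicalComplex.ι_mapBifunctorMap (𝟙 C) (0 : D ⟶ D') (tensorFunctor R G H K)
    (ComplexShape.down ℤ) i j n hij).trans ?_
  rw [HomologicalComplex.zero_f, Functor.map_zero, zero_comp, comp_zero]
  exact comp_zero.symm

lemma Contractible.tensor_left {D : ChainComplex (Rep.{u} R (H × K)) ℤ} (hD : Contractible D)
    (C : ChainComplex (Rep.{u} R (G × H)) ℤ) : Contractible (tensorComplex C D) := by
  obtain ⟨h⟩ := hD
  exact ⟨(Homotopy.ofEq ((tensorComplexLeft K C).map_id D).symm).trans
    ((tensorComplexLeftHomotopy C h).trans (Homotopy.ofEq (tensorComplexLeft_map_zero C D D)))⟩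

end Tensor

/-! ### Duals of homotopies -/

section Dual

variable {R : Type u} [CommRing R] {G H : Type u} [Group G] [Group H]

lemma dualMap_add {M N : Rep.{u} R (G × H)} (f g : M ⟶ N) :
    dualMap (f + g) = dualMap f + dualMap g := by
  apply Rep.hom_ext
  ext α
  exact LinearMap.ext fun m => map_add (show Module.Dual R N from α) _ _

/-- The dual of a morphism of chain complexes of bimodules. -/
def dualComplexMap {C D : ChainComplex (Rep.{u} R (G × H)) ℤ} (f : C ⟶ D) :
    dualComplex D ⟶ dualComplex C where
  f n := dualMap (f.f (-n))
  comm' i j _ := by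
    change dualMap (f.f (-i)) ≫ ((i + 1).negOnePow • dualMap (C.d (-j) (-i))) =
      ((i + 1).negOnePow • dualMap (D.d (-j) (-i))) ≫ dualMap (f.f (-j))
    rw [Linear.comp_units_smul, Linear.units_smul_comp, ← dualMap_comp, ← dualMap_comp, f.comm]

/-- The components of the dual of a homotopy. -/
def dualHomotopyHom {C D : ChainComplex (Rep.{u} R (G × H)) ℤ} {f g : C ⟶ D} (h : Homotopy f g)
    (i j : ℤ) : (dualComplex D).X i ⟶ (dualComplex C).X j :=
  -- The sign is dictated by the sign `(-1)^(i+1)` of the dual differential: the two terms of the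
  -- homotopy relation then carry `(-1)^(i-1) (-1)^(i+1) = 1` and `(-1)^i (-1)^(i+2) = 1`.
  i.negOnePow • dualMap (h.hom (-j) (-i))

/-- The dual of a homotopy. -/
def dualHomotopy {C D : ChainComplex (Rep.{u} R (G × H)) ℤ} {f g : C ⟶ D} (h : Homotopy f g) :
    Homotopy (dualComplexMap f) (dualComplexMap g) where
  hom := dualHomotopyHom h
  zero i j hij := by
    have h0 : h.hom (-j) (-i) = 0 := h.zero _ _ fun h' => hij (by
      change -j + 1 = -i at h'
      change i + 1 = j
      lia)
    exact (congrArg (fun t => i.negOnePow • dualMap t) h0).trans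
      ((congrArg (i.negOnePow • ·) dualMap_zero).trans (smul_zero _))
  comm i := by
    have h1 : (ComplexShape.down ℤ).Rel i (i - 1) := by change i - 1 + 1 = i; lia
    have h2 : (ComplexShape.down ℤ).Rel (i + 1) i := rfl
    have h3 : (ComplexShape.down ℤ).Rel (-(i - 1)) (-i) := by change -i + 1 = -(i - 1); lia
    have h4 : (ComplexShape.down ℤ).Rel (-i) (-(i + 1)) := by change -(i + 1) + 1 = -i; lia
    have hc := h.comm (-i)
    rw [dNext_eq _ h4, prevD_eq _ h3] at hc
    rw [dNext_eq (dualHomotopyHom h) h1, prevD_eq (dualHomotopyHom h) h2]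
    change dualMap (f.f (-i)) = ((i + 1).negOnePow • dualMap (D.d (-(i - 1)) (-i))) ≫
        ((i - 1).negOnePow • dualMap (h.hom (-i) (-(i - 1)))) +
      (i.negOnePow • dualMap (h.hom (-(i + 1)) (-i))) ≫
        ((i + 1 + 1).negOnePow • dualMap (C.d (-i) (-(i + 1)))) + dualMap (g.f (-i))
    -- Transposing reverses composition, so the two terms of the homotopy relation are interchanged.
    rw [hc, dualMap_add, dualMap_add, dualMap_comp, dualMap_comp]
    simp only [Linear.comp_units_smul, Linear.units_smul_comp, smul_smul]
    have e1 : (i - 1).negOnePow * (i + 1).negOnePow = 1 := by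
      rw [← Int.negOnePow_add, Int.negOnePow_even]
      exact ⟨i, by ring⟩
    have e2 : (i + 1 + 1).negOnePow * i.negOnePow = 1 := by
      rw [← Int.negOnePow_add, Int.negOnePow_even]
      exact ⟨i + 1, by ring⟩
    rw [e1, e2, one_smul, one_smul]
    abel

/-- The dual of a homotopy equivalence. -/
def dualHomotopyEquiv {C D : ChainComplex (Rep.{u} R (G × H)) ℤ} (e : HomotopyEquiv C D) :
    HomotopyEquiv (dualComplex C) (dualComplex D) where
  hom := dualComplexMap e.inv
  inv := dualComplexMap e.hom
  homotopyHomInvId := dualHomotopy e.homotopyHomInvId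
  homotopyInvHomId := dualHomotopy e.homotopyInvHomId

end Dual

/-! ### The algebra `RG e` acting on bimodules by tensor product -/

section Unit

variable {R : Type u} [CommRing R] {G K : Type u} [Group G] [Group K]

lemma leftAct_single (N : Rep.{u} R (G × K)) (g : G) (r : R) (n : N) :
    leftAct N (MonoidAlgebra.single g r) n = r • N.ρ (g, 1) n := by
  simp [leftAct]

lemma leftAct_of (N : Rep.{u} R (G × K)) (g : G) (n : N) :
    leftAct N (MonoidAlgebra.of R G g) n = N.ρ (g, 1) n := by
  simp [leftAct]

lemma leftAct_mul (N : Rep.{u} R (G × K)) (a b : R[G]) (n : N) :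
    leftAct N (a * b) n = leftAct N a (leftAct N b n) := by
  simp [leftAct]

lemma leftAct_comm_ρ (N : Rep.{u} R (G × K)) (a : R[G]) (k : K) (n : N) :
    leftAct N a (N.ρ (1, k) n) = N.ρ (1, k) (leftAct N a n) := by
  induction a using MonoidAlgebra.induction_linear with
  | zero => simp [leftAct]
  | add x y hx hy =>
    have h (n : N) : leftAct N (x + y) n = leftAct N x n + leftAct N y n := by simp [leftAct]
    rw [h, h, hx, hy, map_add]
  | single g r => rw [leftAct_single, leftAct_single, ρ_comm_left_right, map_smul]

namespace BlockSum

variable (A : BlockSum R G)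

lemma bimodule_ρ_coe (x : G × G) (a : A.bimodule) :
    (show A.toSubmodule from A.bimodule.ρ x a).1 =
      MonoidAlgebra.of R G x.1 * (show A.toSubmodule from a).1 * MonoidAlgebra.of R G x.2⁻¹ := rfl

/-- The identity element of `RG e` as an element of the bimodule `RG e`. -/
def unit : A.bimodule := (⟨A.idem, A.idem, A.isIdempotentElem⟩ : A.toSubmodule)

/-- The central element `e` is fixed by conjugation. This makes `n ↦ e ⊗ n` equivariant, and later
puts images of `e` in the centre. -/
lemma ρ_unit (g : G) : A.bimodule.ρ (g, g) A.unit = A.unit := by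
  apply Subtype.ext
  refine (A.bimodule_ρ_coe (g, g) A.unit).trans ?_
  have h : MonoidAlgebra.of R G g * A.idem = A.idem * MonoidAlgebra.of R G g :=
    ((Set.mem_center_iff.1 A.central).comm _).eq.symm
  change MonoidAlgebra.of R G g * A.idem * MonoidAlgebra.of R G g⁻¹ = A.idem
  rw [h, mul_assoc, ← map_mul, mul_inv_cancel, map_one, mul_one]

/-- The homomorphism `n ↦ e ⊗ n`. -/
def unitHom (N : Rep.{u} R (G × K)) : N ⟶ tensorObj A.bimodule N :=
  Rep.ofHom (σ := (tensorObj A.bimodule N).ρ)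
    ⟨tensorMk A.bimodule N A.unit, fun x => LinearMap.ext fun n => by
      change tensorMk A.bimodule N A.unit (N.ρ x n) =
        (tensorObj A.bimodule N).ρ x (tensorMk A.bimodule N A.unit n)
      rw [tensorObj_ρ, ← tensorMk_balanced A.bimodule N x.1 _ (N.ρ (1, x.2) n),
        ← ρ_comm_left_right, ← ρ_eq_left_right, ρ_unit, ← ρ_eq_left_right]⟩

/-- The homomorphism `a ⊗ n ↦ a n`. -/
def actHom (N : Rep.{u} R (G × K)) : tensorObj A.bimodule N ⟶ N :=
  tensorLift ((Representation.asAlgebraHom (N.ρ.comp (MonoidHom.inl G K))).toLinearMap ∘ₗ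
      A.toSubmodule.subtype)
    (fun h m n => by
      change leftAct N (show A.toSubmodule from A.bimodule.ρ (1, h) m).1 (N.ρ (h, 1) n) =
        leftAct N (show A.toSubmodule from m).1 n
      rw [bimodule_ρ_coe, leftAct_mul, map_one, one_mul, leftAct_of, ρ_left_inv])
    (fun g k m n => by
      change leftAct N (show A.toSubmodule from A.bimodule.ρ (g, 1) m).1 (N.ρ (1, k) n) =
        N.ρ (g, k) (leftAct N (show A.toSubmodule from m).1 n)
      rw [bimodule_ρ_coe, inv_one, map_one, mul_one, leftAct_mul, leftAct_comm_ρ, leftAct_of,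
        ← ρ_eq_left_right])

/-- The composite is `n ↦ e n`. The opposite composite is not needed, because contractibility
already passes to retracts. -/
lemma unitHom_actHom (N : Rep.{u} R (G × K)) (hN : leftAct N A.idem = 1) :
    A.unitHom N ≫ A.actHom N = 𝟙 N := by
  apply Rep.hom_ext
  ext n
  exact LinearMap.congr_fun hN n

lemma unitHom_naturality {N N' : Rep.{u} R (G × K)} (f : N ⟶ N') :
    f ≫ A.unitHom N' = A.unitHom N ≫ tensorMap (𝟙 _) f := rfl

lemma actHom_naturality {N N' : Rep.{u} R (G × K)} (f : N ⟶ N') :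
    tensorMap (𝟙 _) f ≫ A.actHom N' = A.actHom N ≫ f :=
  tensorHom_ext fun m n => (hom_leftAct f (show A.toSubmodule from m).1 n).symm

/-- The bimodule `RG e` as a complex concentrated in degree `0`. -/
abbrev complex : ChainComplex (Rep.{u} R (G × G)) ℤ :=
  (HomologicalComplex.single _ (ComplexShape.down ℤ) 0).obj A.bimodule

end BlockSum

end Unit

/-! ### Tensoring a complex with `RG e` in degree `0` -/

section UnitComplex

open HomologicalComplex

variable {R : Type u} [CommRing R] {G K : Type u} [Group G] [Group K] (A : BlockSum R G)
  (X : ChainComplex (Rep.{u} R (G × K)) ℤ)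

lemma π_zero_left (n : ℤ) :
    ComplexShape.π (ComplexShape.down ℤ) (ComplexShape.down ℤ) (ComplexShape.down ℤ) (0, n) = n :=
  zero_add n

/-- The inclusion of the summands of `A ⊗ X`. -/
def tensorUnitInclusion (n : ℤ) :
    tensorObj (A.complex.X 0) (X.X n) ⟶ (tensorComplex A.complex X).X n :=
  ιMapBifunctor A.complex X (tensorFunctor R G G K) (ComplexShape.down ℤ) 0 n n (π_zero_left n)

/-- The components of the chain map `x ↦ e ⊗ x`. -/
def unitComplexHomAux (n : ℤ) : X.X n ⟶ (tensorComplex A.complex X).X n :=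
  A.unitHom (X.X n) ≫ tensorMap (singleObjXSelf (ComplexShape.down ℤ) 0 A.bimodule).inv (𝟙 _) ≫
    tensorUnitInclusion A X n

lemma tensorMap_comp {R : Type u} [CommRing R] {G H K : Type u} [Group G] [Group H] [Group K]
    {M M' M'' : Rep.{u} R (G × H)} {N N' N'' : Rep.{u} R (H × K)} (f : M ⟶ M') (f' : M' ⟶ M'')
    (g : N ⟶ N') (g' : N' ⟶ N'') :
    tensorMap (f ≫ f') (g ≫ g') = tensorMap f g ≫ tensorMap f' g' :=
  tensorHom_ext fun _ _ => rfl

/-- On the summand in bidegree `(0, n)` the differential of `RG e` contributes nothing, and that of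
`X` carries the sign `(-1)^0 = 1`. -/
lemma ι_tensorComplex_single_d {n n' : ℤ} (h : (ComplexShape.down ℤ).Rel n n') :
    tensorUnitInclusion A X n ≫
      (tensorComplex A.complex X).d n n' = tensorMap (𝟙 _) (X.d n n') ≫
    tensorUnitInclusion A X n' := by
  have key : ιMapBifunctor A.complex X (tensorFunctor R G G K) (ComplexShape.down ℤ) 0 n n
        (π_zero_left n) ≫
      (mapBifunctor.D₁ A.complex X (tensorFunctor R G G K) (ComplexShape.down ℤ) n n' +
        mapBifunctor.D₂ A.complex X (tensorFunctor R G G K) (ComplexShape.down ℤ) n n') =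
      ((tensorFunctor R G G K).obj (A.complex.X 0)).map (X.d n n') ≫
        ιMapBifunctor A.complex X (tensorFunctor R G G K) (ComplexShape.down ℤ) 0 n' n'
          (π_zero_left n') := by
    have h1 : ComplexShape.ε₂ (ComplexShape.down ℤ) (ComplexShape.down ℤ) (ComplexShape.down ℤ)
        ((0 : ℤ), n) = 1 := Int.negOnePow_zero
    rw [Preadditive.comp_add, mapBifunctor.ι_D₁, mapBifunctor.ι_D₂,
      mapBifunctor.d₁_eq' _ _ _ _ (show (ComplexShape.down ℤ).Rel 0 (-1) from rfl),
      single_obj_d, Functor.map_zero, zero_app, zero_comp, smul_zero, zero_add,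
      mapBifunctor.d₂_eq _ _ _ _ _ h _ (π_zero_left n'), h1, one_smul]
  exact key

/-- The components of the chain map `a ⊗ x ↦ a x`. -/
def actComplexHomAux (n : ℤ) : (tensorComplex A.complex X).X n ⟶ X.X n :=
  -- The value `0` for `i ≠ 0` is forced, since `A.complex` vanishes in degree `i`.
  mapBifunctorDesc fun i j h => if hi : i = 0 then
      tensorMap (singleObjXIsoOfEq (ComplexShape.down ℤ) 0 A.bimodule i hi).hom (𝟙 _) ≫
        A.actHom (X.X j) ≫ (X.XIsoOfEq (by subst hi; exact (zero_add j).symm.trans h)).hom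
    else 0

lemma ι_actComplexHomAux (n : ℤ) :
    tensorUnitInclusion A X n ≫
      actComplexHomAux A X n =
    tensorMap (singleObjXSelf (ComplexShape.down ℤ) 0 A.bimodule).hom (𝟙 _) ≫
      A.actHom (X.X n) := by
  refine (ι_mapBifunctorDesc _ 0 n (π_zero_left n)).trans ?_
  rw [dif_pos rfl, XIsoOfEq_rfl, Iso.refl_hom, Category.comp_id]
  rfl

/-- All summands in bidegrees `(i, j)` with `i ≠ 0` are zero, so only the one in bidegree `(0, n)`
counts. -/
lemma tensorComplex_single_hom_ext {n : ℤ} {W : Rep.{u} R (G × K)}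
    {f g : (tensorComplex A.complex X).X n ⟶ W}
    (h : tensorUnitInclusion A X n ≫ f =
      tensorUnitInclusion A X n ≫ g) : f = g := by
  apply mapBifunctor.hom_ext
  intro i j hij
  by_cases hi : i = 0
  · subst hi
    obtain rfl : j = n := (zero_add j).symm.trans hij
    exact h
  · exact (((tensorFunctor R G G K).flip.obj (X.X j)).map_isZero
      (isZero_single_obj_X (ComplexShape.down ℤ) 0 A.bimodule i hi)).eq_of_src _ _

/-- A complex of left `RG e`-modules is a retract of its tensor product with `RG e`. -/
def tensorUnitRetract (hX : ∀ n, leftAct (X.X n) A.idem = 1) :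
    Retract X (tensorComplex A.complex X) where
  i :=
    { f := unitComplexHomAux A X
      comm' n n' h := by
        rw [unitComplexHomAux, unitComplexHomAux, Category.assoc, Category.assoc,
          ι_tensorComplex_single_d A X h, ← Category.assoc (X.d n n'), A.unitHom_naturality,
          Category.assoc, ← Category.assoc (tensorMap _ _) (tensorMap _ _),
          ← Category.assoc (tensorMap _ _) (tensorMap _ _), ← tensorMap_comp, ← tensorMap_comp]
        simp only [Category.id_comp, Category.comp_id] }
  r :=
    { f := actComplexHomAux A X
      comm' n n' h := by
        apply tensorComplex_single_hom_ext
        rw [← Category.assoc, ι_actComplexHomAux, ← Category.assoc, ι_tensorComplex_single_d A X h,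
          Category.assoc, Category.assoc, ι_actComplexHomAux, ← A.actHom_naturality,
          ← Category.assoc (tensorMap _ _) (tensorMap _ _),
          ← Category.assoc (tensorMap _ _) (tensorMap _ _), ← tensorMap_comp, ← tensorMap_comp]
        simp only [Category.id_comp, Category.comp_id] }
  retract := by
    ext n : 1
    change unitComplexHomAux A X n ≫ actComplexHomAux A X n = 𝟙 _
    rw [unitComplexHomAux, Category.assoc, Category.assoc, ι_actComplexHomAux,
      ← Category.assoc (tensorMap _ _) (tensorMap _ _), ← tensorMap_comp, Iso.inv_hom_id,
      Category.comp_id]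
    exact A.unitHom_actHom _ (hX n)

end UnitComplex

/-! ### Endomorphisms of the bimodule `RG e` -/

section Blocks

variable {R : Type u} [CommRing R] {G : Type u} [Group G]

namespace BlockSum

variable (A : BlockSum R G)

/-- An element of the bimodule `RG e` as an element of `RG`. -/
def coe (x : A.bimodule) : R[G] := (show A.toSubmodule from x).1

lemma coe_injective : Function.Injective A.coe := Subtype.val_injective

lemma coe_smul (r : R) (x : A.bimodule) : A.coe (r • x) = r • A.coe x := rfl

lemma coe_unit : A.coe A.unit = A.idem := rfl

lemma coe_ρ (x : G × G) (a : A.bimodule) :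
    A.coe (A.bimodule.ρ x a) = MonoidAlgebra.of R G x.1 * A.coe a * MonoidAlgebra.of R G x.2⁻¹ :=
  rfl

lemma coe_leftAct (a : R[G]) (x : A.bimodule) : A.coe (leftAct A.bimodule a x) = a * A.coe x := by
  induction a using MonoidAlgebra.induction_linear with
  | zero =>
    rw [zero_mul, leftAct, map_zero]
    rfl
  | add a b ha hb =>
    rw [add_mul, ← ha, ← hb, leftAct, map_add]
    rfl
  | single g r =>
    rw [leftAct_single, coe_smul, coe_ρ]
    simp [← MonoidAlgebra.one_def, ← smul_mul_assoc]

lemma idem_mul_coe (x : A.bimodule) : A.idem * A.coe x = A.coe x := by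
  obtain ⟨_, y, rfl⟩ := x
  change A.idem * (A.idem * y) = A.idem * y
  rw [← mul_assoc, A.isIdempotentElem]

lemma mul_idem (x : R[G]) : x * A.idem = A.idem * x :=
  ((Set.mem_center_iff.1 A.central).comm x).eq.symm

/-- The endomorphisms of the bimodule `RG e` are multiplications. -/
lemma coe_hom_apply (φ : A.bimodule ⟶ A.bimodule) (x : A.bimodule) :
    A.coe (φ.hom x) = A.coe x * A.coe (φ.hom A.unit) := by
  -- Every `x` in `RG e` equals `x e`, so left linearity determines `φ` by its value at `e`.
  have h : leftAct A.bimodule (A.coe x) A.unit = x := A.coe_injective (by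
    rw [coe_leftAct, coe_unit, mul_idem, idem_mul_coe])
  rw [← coe_leftAct, ← hom_leftAct, h]

lemma mem_center_of_forall_of (z : R[G])
    (hz : ∀ g, MonoidAlgebra.of R G g * z = z * MonoidAlgebra.of R G g) : z ∈ Set.center R[G] := by
  rw [Semigroup.mem_center_iff]
  intro a
  induction a using MonoidAlgebra.induction_linear with
  | zero => simp
  | add a b ha hb => rw [add_mul, mul_add, ha, hb]
  | single g r =>
    have h : MonoidAlgebra.single g r = r • MonoidAlgebra.of R G g := by simp
    rw [h, smul_mul_assoc, hz, mul_smul_comm]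

/-- Every pair `(g, g)` fixes `e`, hence also its image under the equivariant map `φ`; being fixed
by conjugation means commuting with all `g`. -/
lemma coe_hom_unit_mem_center (φ : A.bimodule ⟶ A.bimodule) :
    A.coe (φ.hom A.unit) ∈ Set.center R[G] :=
  mem_center_of_forall_of _ fun g => by
    have h := Rep.hom_comm_apply φ (g, g) A.unit
    rw [ρ_unit] at h
    conv_rhs => rw [h, coe_ρ, mul_assoc, ← map_mul, inv_mul_cancel, map_one, mul_one]

/-- The bimodule of a block has no nontrivial idempotent endomorphisms. -/
lemma IsBlock.eq_zero_or_eq_id {A : BlockSum R G} (hA : A.IsBlock) (φ : A.bimodule ⟶ A.bimodule)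
    (hφ : φ ≫ φ = φ) : φ = 0 ∨ φ = 𝟙 A.bimodule := by
  -- The element `φ(e)` is a central idempotent lying in `RG e`, so it is `0` or `e` because the
  -- block idempotent is primitive in the centre.
  have h1 : φ.hom (φ.hom A.unit) = φ.hom A.unit :=
    congrArg (fun f : A.bimodule ⟶ A.bimodule => f.hom A.unit) hφ
  have h2 : IsIdempotentElem (A.coe (φ.hom A.unit)) := by
    rw [IsIdempotentElem, ← coe_hom_apply, h1]
  obtain h | h := hA.2 _ h2 (A.coe_hom_unit_mem_center φ) (by rw [mul_idem, idem_mul_coe])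
  · left
    apply Rep.hom_ext
    ext x
    apply A.coe_injective
    refine (A.coe_hom_apply φ x).trans ?_
    rw [h, mul_zero]
    rfl
  · right
    apply Rep.hom_ext
    ext x
    apply A.coe_injective
    refine (A.coe_hom_apply φ x).trans ?_
    rw [h, mul_idem, idem_mul_coe]
    rfl

lemma IsBlock.id_ne_zero {A : BlockSum R G} (hA : A.IsBlock) : 𝟙 A.bimodule ≠ 0 := fun h =>
  hA.1 (congrArg (fun f : A.bimodule ⟶ A.bimodule => A.coe (f.hom A.unit)) h)

end BlockSum

end Blocks

/-! ### Block bimodules as complexes in degree `0` -/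

section Single

open HomologicalComplex

/-- All differentials vanish, so a homotopy contributes nothing in degree `0`. Identities up to
homotopy thus become identities of bimodule maps. -/
lemma eq_of_homotopy_single {𝓒 : Type*} [Category 𝓒] [Preadditive 𝓒] [HasZeroObject 𝓒] {X Y : 𝓒}
    {f g : (single 𝓒 (ComplexShape.down ℤ) 0).obj X ⟶ (single 𝓒 (ComplexShape.down ℤ) 0).obj Y}
    (h : Homotopy f g) : f = g := by
  apply from_single_hom_ext
  rw [h.comm, dNext_eq _ (show (ComplexShape.down ℤ).Rel 0 (-1) from rfl),
    prevD_eq _ (show (ComplexShape.down ℤ).Rel 1 0 from rfl), single_obj_d, single_obj_d, zero_comp,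
    comp_zero, zero_add, zero_add]

variable {R : Type u} [CommRing R] {G : Type u} [Group G] {A : BlockSum R G}

/-- The complex of a block has no nontrivial idempotent endomorphisms up to homotopy. -/
lemma BlockSum.IsBlock.eq_zero_or_eq_id_of_homotopy (hA : A.IsBlock) (φ : A.complex ⟶ A.complex)
    (h : Homotopy (φ ≫ φ) φ) : φ = 0 ∨ φ = 𝟙 A.complex := by
  obtain ⟨ψ, rfl⟩ := (single _ (ComplexShape.down ℤ) 0).map_surjective φ
  have hψ : ψ ≫ ψ = ψ := (single _ (ComplexShape.down ℤ) 0).map_injective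
    ((Functor.map_comp _ _ _).trans (eq_of_homotopy_single h))
  obtain rfl | rfl := hA.eq_zero_or_eq_id ψ hψ
  · exact Or.inl (Functor.map_zero _ _ _)
  · exact Or.inr (CategoryTheory.Functor.map_id _ _)

lemma BlockSum.IsBlock.not_contractible (hA : A.IsBlock) : ¬ Contractible A.complex := by
  rintro ⟨h⟩
  apply hA.id_ne_zero
  apply (single _ (ComplexShape.down ℤ) 0).map_injective
  rw [CategoryTheory.Functor.map_id, Functor.map_zero, eq_of_homotopy_single h]

end Single

/-! ### Detecting contractibility after tensoring -/

section Cancellation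

variable {R : Type u} [CommRing R] {G H K : Type u} [Group G] [Group H] [Group K]

/-- Tensoring with `C^*` detects contractibility if `C ⊗ C^* ≃ A`. -/
lemma contractible_of_dual_tensor {A : BlockSum R G} {C : ChainComplex (Rep.{u} R (G × H)) ℤ}
    (e : HomotopyEquiv (tensorComplex C (dualComplex C)) A.complex)
    {X : ChainComplex (Rep.{u} R (G × K)) ℤ} (hX : ∀ n, leftAct (X.X n) A.idem = 1)
    (h : Contractible (tensorComplex (dualComplex C) X)) : Contractible X := by
  -- By associativity, `C ⊗ (C^* ⊗ X)` is `(C ⊗ C^*) ⊗ X ≃ A ⊗ X`, which has `X` as a retract.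
  have h1 : Contractible (tensorComplex (tensorComplex C (dualComplex C)) X) :=
    (h.tensor_left C).of_homotopyEquiv
      (HomotopyEquiv.ofIso (tensorComplexAssoc C (dualComplex C) X))
  have h2 : Contractible (tensorComplex A.complex X) :=
    h1.of_homotopyEquiv (tensorHomotopyEquiv e.symm (HomotopyEquiv.refl X))
  exact h2.of_retract (tensorUnitRetract A X hX)

/-- If `X` and `Z` are orthogonal retracts of `C` up to homotopy, and `F` is a functor such that
`F C` is homotopy equivalent to the complex of a block, then `F X` or `F Z` is contractible. -/
lemma contractible_or_contractible {𝓒 : Type*} [Category 𝓒] [Preadditive 𝓒]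
    {B : BlockSum R H} (hB : B.IsBlock)
    (F : ChainComplex 𝓒 ℤ ⥤ ChainComplex (Rep.{u} R (H × H)) ℤ)
    (hF : ∀ {X Y : ChainComplex 𝓒 ℤ} {f g : X ⟶ Y}, Homotopy f g → Homotopy (F.map f) (F.map g))
    (hF0 : ∀ X Y : ChainComplex 𝓒 ℤ, F.map (0 : X ⟶ Y) = 0)
    {C X Z : ChainComplex 𝓒 ℤ} (e : HomotopyEquiv (F.obj C) B.complex)
    (i : X ⟶ C) (p : C ⟶ X) (j : Z ⟶ C) (q : C ⟶ Z) (hip : Homotopy (i ≫ p) (𝟙 X))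
    (hjq : Homotopy (j ≫ q) (𝟙 Z)) (hjp : Homotopy (j ≫ p) 0) :
    Contractible (F.obj X) ∨ Contractible (F.obj Z) := by
  have h1 : Homotopy ((p ≫ i) ≫ p ≫ i) (p ≫ i) :=
    (Homotopy.ofEq (by simp)).trans (((hip.compRight i).compLeft p).trans (Homotopy.ofEq (by simp)))
  -- The idempotent `p ≫ i`, carried by `F` and `e` to the complex of the block, is still idempotent
  -- up to homotopy.
  have h2 : Homotopy ((e.inv ≫ F.map (p ≫ i) ≫ e.hom) ≫ e.inv ≫ F.map (p ≫ i) ≫ e.hom)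
      (e.inv ≫ F.map (p ≫ i) ≫ e.hom) :=
    (Homotopy.ofEq (by simp only [Category.assoc])).trans
      ((((e.homotopyHomInvId.compRight (F.map (p ≫ i) ≫ e.hom)).compLeft
        (e.inv ≫ F.map (p ≫ i)))).trans ((Homotopy.ofEq (by simp)).trans
          ((((hF h1).compRight e.hom).compLeft e.inv))))
  have h3 : Homotopy (F.map (p ≫ i))
      (e.hom ≫ (e.inv ≫ F.map (p ≫ i) ≫ e.hom) ≫ e.inv) :=
    (Homotopy.ofEq (by simp)).trans (((e.homotopyHomInvId.symm.comp
      (Homotopy.refl (F.map (p ≫ i)))).comp e.homotopyHomInvId.symm).trans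
        (Homotopy.ofEq (by simp only [Category.assoc])))
  obtain h | h := hB.eq_zero_or_eq_id_of_homotopy _ h2
  · left
    rw [h, zero_comp, comp_zero] at h3
    -- If the transported idempotent is `0`, then so is `F` of `p ≫ i` up to homotopy, and the
    -- identity of `X` is homotopic to `i ≫ (p ≫ i) ≫ p`.
    have h4 : Homotopy (F.map (i ≫ (p ≫ i) ≫ p)) 0 :=
      (Homotopy.ofEq (by simp only [F.map_comp])).trans
        (((h3.compRight (F.map p)).compLeft (F.map i)).trans (Homotopy.ofEq (by simp)))
    have h5 : Homotopy (i ≫ (p ≫ i) ≫ p) (𝟙 X) :=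
      (Homotopy.ofEq (by simp only [Category.assoc])).trans
        ((hip.comp hip).trans (Homotopy.ofEq (by simp)))
    exact ⟨(Homotopy.ofEq (F.map_id X).symm).trans ((hF h5.symm).trans h4)⟩
  · right
    rw [h, Category.id_comp] at h3
    -- If it is the identity, then inserting `p ≫ i` between `j` and `q` does not change the image
    -- under `F` up to homotopy. But `j ≫ p` is null-homotopic, while `j ≫ q` is homotopic to the
    -- identity of `Z`.
    have h4 : Homotopy (F.map (j ≫ (p ≫ i) ≫ q)) (F.map (j ≫ q)) :=
      (Homotopy.ofEq (by simp only [F.map_comp])).trans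
        ((((h3.trans e.homotopyHomInvId).compRight (F.map q)).compLeft (F.map j)).trans
          (Homotopy.ofEq (by simp)))
    have h5 : Homotopy (j ≫ (p ≫ i) ≫ q) 0 :=
      (Homotopy.ofEq (by simp only [Category.assoc])).trans
        ((hjp.compRight (i ≫ q)).trans (Homotopy.ofEq (by simp)))
    exact ⟨(Homotopy.ofEq (F.map_id Z).symm).trans ((hF hjq.symm).trans (h4.symm.trans
      ((hF h5).trans (Homotopy.ofEq (hF0 Z Z)))))⟩

end Cancellation

/-! ### Indecomposability in the homotopy category -/

section Indecomposability

variable {R : Type u} [CommRing R] {G H : Type u} [Group G] [Group H]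
  {p : ℕ} {A : BlockSum R G} {B : BlockSum R H} {C : ChainComplex (Rep.{u} R (G × H)) ℤ}

lemma isZero_toHomotopyCategory_iff (hC : IsBimoduleComplex A B C) :
    IsZero (toHomotopyCategory C hC) ↔ Contractible C := by
  have h : IsZero (toHomotopyCategory C hC) ↔
      IsZero ((HomotopyCategory.quotient _ (ComplexShape.down ℤ)).obj C) := by
    rw [IsZero.iff_id_eq_zero, IsZero.iff_id_eq_zero]
    exact ⟨fun h => congrArg (·.hom) h, fun h => ObjectProperty.hom_ext _ h⟩
  rw [h, HomotopyCategory.isZero_quotient_obj_iff]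
  rfl

/-- Otherwise `C^* ⊗ C`, and with it the complex of the block `B`, would be contractible. -/
lemma IsSplendidRickardComplex.not_contractible (hC : IsSplendidRickardComplex p A B C)
    (hB : B.IsBlock) : ¬ Contractible C := fun h => by
  obtain ⟨e⟩ := hC.dual_tensor
  exact hB.not_contractible ((h.tensor_left (dualComplex C)).of_homotopyEquiv e.symm)

/-- The equivalence `C^* ⊗ C ≃ B` forces one summand to die under `C^* ⊗ -`, and `C ⊗ C^* ≃ A`
removes that functor again. The relations are required only up to homotopy, so that decompositions
in `K^b` and strict decompositions of complexes are both covered. -/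
lemma IsSplendidRickardComplex.contractible_or_contractible
    (hC : IsSplendidRickardComplex p A B C) (hB : B.IsBlock)
    {X Z : ChainComplex (Rep.{u} R (G × H)) ℤ} (hX : ∀ n, leftAct (X.X n) A.idem = 1)
    (hZ : ∀ n, leftAct (Z.X n) A.idem = 1)
    (i : X ⟶ C) (p : C ⟶ X) (j : Z ⟶ C) (q : C ⟶ Z) (hip : Homotopy (i ≫ p) (𝟙 X))
    (hjq : Homotopy (j ≫ q) (𝟙 Z)) (hjp : Homotopy (j ≫ p) 0) :
    Contractible X ∨ Contractible Z := by
  obtain ⟨e⟩ := hC.dual_tensor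
  obtain ⟨e'⟩ := hC.tensor_dual
  exact (Splendid.contractible_or_contractible hB (tensorComplexLeft H (dualComplex C))
    (tensorComplexLeftHomotopy _) (tensorComplexLeft_map_zero _) e i p j q hip hjq hjp).imp
      (contractible_of_dual_tensor e' hX) (contractible_of_dual_tensor e' hZ)

/-- A splendid Rickard complex is indecomposable in the bounded homotopy category. -/
lemma IsSplendidRickardComplex.indecomposable_toHomotopyCategory
    (hC : IsSplendidRickardComplex p A B C) (hB : B.IsBlock) :
    Indecomposable (toHomotopyCategory C hC.bimoduleComplex) := by
  refine ⟨fun h => hC.not_contractible hB ((isZero_toHomotopyCategory_iff _).1 h),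
    fun Y Z t => ?_⟩
  have hY : IsZero Y ↔ Contractible Y.obj.as := isZero_toHomotopyCategory_iff Y.property
  have hZ : IsZero Z ↔ Contractible Z.obj.as := isZero_toHomotopyCategory_iff Z.property
  rw [hY, hZ]
  let Q := HomotopyCategory.quotient (Rep.{u} R (G × H)) (ComplexShape.down ℤ)
  -- The inclusions and projections of the decomposition lift to chain maps, whose relations hold up
  -- to homotopy.
  obtain ⟨i, hi⟩ : ∃ i : Y.obj.as ⟶ C, Q.map i = (biprod.inl ≫ t.inv).hom := Q.map_surjective _
  obtain ⟨p, hp⟩ : ∃ p : C ⟶ Y.obj.as, Q.map p = (t.hom ≫ biprod.fst).hom := Q.map_surjective _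
  obtain ⟨j, hj⟩ : ∃ j : Z.obj.as ⟶ C, Q.map j = (biprod.inr ≫ t.inv).hom := Q.map_surjective _
  obtain ⟨q, hq⟩ : ∃ q : C ⟶ Z.obj.as, Q.map q = (t.hom ≫ biprod.snd).hom := Q.map_surjective _
  have h1 : (biprod.inl ≫ t.inv) ≫ t.hom ≫ biprod.fst = 𝟙 Y := by simp
  have h2 : (biprod.inr ≫ t.inv) ≫ t.hom ≫ biprod.snd = 𝟙 Z := by simp
  have h3 : (biprod.inr ≫ t.inv) ≫ t.hom ≫ biprod.fst = (0 : Z ⟶ Y) := by simp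
  refine hC.contractible_or_contractible hB (fun n => (Y.property.bimodule n).left)
    (fun n => (Z.property.bimodule n).left) i p j q (HomotopyCategory.homotopyOfEq _ _ ?_)
    (HomotopyCategory.homotopyOfEq _ _ ?_) (HomotopyCategory.homotopyOfEq _ _ ?_)
  · rw [Functor.map_comp, CategoryTheory.Functor.map_id, hi, hp]
    exact congrArg (·.hom) h1
  · rw [Functor.map_comp, CategoryTheory.Functor.map_id, hj, hq]
    exact congrArg (·.hom) h2
  · rw [Functor.map_comp, Functor.map_zero, hj, hp]
    exact congrArg (·.hom) h3

end Indecomposability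

/-! ### Direct summands of bounded complexes of bimodules -/

section Summands

variable {R : Type u} [CommRing R] {G H : Type u} [Group G] [Group H]
  {A : BlockSum R G} {B : BlockSum R H} {C D : ChainComplex (Rep.{u} R (G × H)) ℤ}

lemma IsBimodule.of_retract {M N : Rep.{u} R (G × H)} (hN : IsBimodule A B N) (r : Retract M N) :
    IsBimodule A B M := by
  have h (m : M) : r.r.hom (r.i.hom m) = m := congrArg (fun f : M ⟶ M => f.hom m) r.retract
  have := hN.finite
  refine ⟨finite_of_isDirectSummand (.of_retract r), LinearMap.ext fun m => ?_,
    LinearMap.ext fun m => ?_⟩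
  · rw [← h m, ← hom_leftAct, hN.left]
    rfl
  · rw [← h m, ← hom_rightAct, hN.right]
    rfl

lemma IsDirectSummand.eval (h : IsDirectSummand D C) (n : ℤ) :
    IsDirectSummand (D.X n) (C.X n) :=
  h.map (HomologicalComplex.eval _ _ n)

lemma IsBimoduleComplex.of_isDirectSummand (hC : IsBimoduleComplex A B C)
    (h : IsDirectSummand D C) : IsBimoduleComplex A B D := by
  obtain ⟨r⟩ := h.nonempty_retract
  have hr (n : ℤ) : Retract (D.X n) (C.X n) := r.map (HomologicalComplex.eval _ _ n)
  obtain ⟨a, b, hab⟩ := hC.bounded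
  refine ⟨fun n => (hC.bimodule n).of_retract (hr n), a, b, fun n hn => ?_⟩
  rw [IsZero.iff_id_eq_zero, ← (hr n).retract, (hab n hn).eq_of_tgt (hr n).i 0, zero_comp]

lemma Contractible.of_biprod_iso {X Y Z : ChainComplex (Rep.{u} R (G × H)) ℤ} (e : X ≅ Y ⊞ Z)
    (hY : Contractible Y) (hZ : Contractible Z) : Contractible X := by
  obtain ⟨h⟩ := hY
  obtain ⟨h'⟩ := hZ
  have h1 : Contractible (Y ⊞ Z) :=
    ⟨(Homotopy.ofEq (by simp)).trans
      ((((h.compRight biprod.inl).compLeft biprod.fst).add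
        ((h'.compRight biprod.inr).compLeft biprod.snd)).trans (Homotopy.ofEq (by simp)))⟩
  exact h1.of_retract (Retract.ofIso e)

/-- A contractible direct summand of a complex can be removed up to homotopy equivalence. -/
def homotopyEquivOfContractible {X Y Z : ChainComplex (Rep.{u} R (G × H)) ℤ} (e : X ≅ Y ⊞ Z)
    (h : Homotopy (𝟙 Z) 0) : HomotopyEquiv X Y where
  hom := e.hom ≫ biprod.fst
  inv := biprod.inl ≫ e.inv
  homotopyHomInvId :=
    (Homotopy.ofEq (by simp)).trans
      (((Homotopy.refl ((e.hom ≫ biprod.fst) ≫ biprod.inl ≫ e.inv)).add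
        ((h.symm.compRight (biprod.inr ≫ e.inv)).compLeft (e.hom ≫ biprod.snd))).trans
          (Homotopy.ofEq (by
            have ht : e.hom ≫ (biprod.fst ≫ biprod.inl + biprod.snd ≫ biprod.inr) ≫ e.inv = 𝟙 X := by
              rw [biprod.total, Category.id_comp, Iso.hom_inv_id]
            simpa only [Preadditive.add_comp, Preadditive.comp_add, Category.assoc,
              Category.id_comp] using ht)))
  homotopyInvHomId := Homotopy.ofEq (by simp)

/-- The endomorphism algebra of a bounded complex of finitely generated bimodules is finite. -/
lemma IsBimoduleComplex.finite_end [IsNoetherianRing R] {X : ChainComplex (Rep.{u} R (G × H)) ℤ}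
    (hX : IsBimoduleComplex A B X) : Module.Finite R (End X) := by
  obtain ⟨a, b, hab⟩ := hX.bounded
  have (n : ℤ) : Module.Finite R (X.X n) := (hX.bimodule n).finite
  -- Boundedness embeds the endomorphisms of `X` into a finite product of endomorphism algebras of
  -- its terms.
  let f : End X →ₗ[R] ∀ n : Finset.Icc a b, End (X.X n) :=
    { toFun g n := g.f n
      map_add' _ _ := rfl
      map_smul' _ _ := rfl }
  refine Module.Finite.of_injective f fun g g' h => ?_
  apply HomologicalComplex.Hom.ext
  funext n
  by_cases hn : n ∈ Finset.Icc a b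
  · exact congrFun h ⟨n, hn⟩
  · refine (hab n ?_).eq_of_src _ _
    rw [Finset.mem_Icc] at hn
    lia

lemma IsSplendidRickardComplex.contractible_of_iso_biprod {p : ℕ}
    {Z : ChainComplex (Rep.{u} R (G × H)) ℤ} (hC : IsSplendidRickardComplex p A B C)
    (hB : B.IsBlock) (e : C ≅ D ⊞ Z) (hD : ¬ Contractible D) : Contractible Z := by
  have hD' := hC.bimoduleComplex.of_isDirectSummand (.left e)
  have hZ' := hC.bimoduleComplex.of_isDirectSummand (.right e)
  exact (hC.contractible_or_contractible hB (fun n => (hD'.bimodule n).left)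
    (fun n => (hZ'.bimodule n).left) (biprod.inl ≫ e.inv) (e.hom ≫ biprod.fst)
    (biprod.inr ≫ e.inv) (e.hom ≫ biprod.snd) (Homotopy.ofEq (by simp)) (Homotopy.ofEq (by simp))
    (Homotopy.ofEq (by simp))).resolve_left hD

end Summands

/-! ### Existence of an indecomposable noncontractible summand -/

section Rank

open IsLocalRing

variable {R : Type u} [CommRing R] [IsLocalRing R] {G H : Type u} [Group G] [Group H]
  {A : BlockSum R G} {B : BlockSum R H}

/-- The total residue rank of a complex in the degrees from `a` to `b`. -/
def complexRank (a b : ℤ) (X : ChainComplex (Rep.{u} R (G × H)) ℤ) : ℕ :=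
  ∑ n ∈ Finset.Icc a b, residueRank R (X.X n)

lemma complexRank_eq_add (a b : ℤ) {X Y Z : ChainComplex (Rep.{u} R (G × H)) ℤ}
    (hX : IsBimoduleComplex A B X) (e : X ≅ Y ⊞ Z) :
    complexRank a b X = complexRank a b Y + complexRank a b Z := by
  rw [complexRank, complexRank, complexRank, ← Finset.sum_add_distrib]
  refine Finset.sum_congr rfl fun n _ => ?_
  have := (hX.bimodule n).finite
  let F := HomologicalComplex.eval (Rep.{u} R (G × H)) (ComplexShape.down ℤ) n
  exact residueRank_eq_of_iso_biprod (F.mapIso e ≪≫ F.mapBiprod Y Z)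

lemma complexRank_pos {a b : ℤ} {X : ChainComplex (Rep.{u} R (G × H)) ℤ}
    (hX : IsBimoduleComplex A B X) (hab : ∀ n, n < a ∨ b < n → IsZero (X.X n)) (h : ¬ IsZero X) :
    0 < complexRank a b X := by
  obtain ⟨n, hn⟩ : ∃ n, ¬ IsZero (X.X n) := by
    by_contra! h'
    apply h
    rw [IsZero.iff_id_eq_zero]
    ext n : 1
    exact (h' n).eq_of_src _ _
  have hn' : n ∈ Finset.Icc a b := by
    by_contra h'
    refine hn (hab n ?_)
    rw [Finset.mem_Icc] at h'
    lia
  have := (hX.bimodule n).finite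
  have : Nontrivial (X.X n) := by
    by_contra h'
    rw [not_nontrivial_iff_subsingleton] at h'
    apply hn
    rw [IsZero.iff_id_eq_zero]
    apply Rep.hom_ext
    ext m
    exact Subsingleton.elim _ _
  exact (residueRank_pos (R := R) (M := X.X n)).trans_le
    (Finset.single_le_sum (f := fun n => residueRank R (X.X n)) (fun _ _ => Nat.zero_le _) hn')

/-- A noncontractible bounded complex has an indecomposable noncontractible direct summand. -/
lemma IsBimoduleComplex.exists_indecomposable_summand {X : ChainComplex (Rep.{u} R (G × H)) ℤ}
    (hX : IsBimoduleComplex A B X) (h : ¬ Contractible X) :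
    ∃ D, IsDirectSummand D X ∧ Indecomposable D ∧ ¬ Contractible D := by
  obtain ⟨a, b, hab⟩ := hX.bounded
  induction hN : complexRank a b X using Nat.strong_induction_on generalizing X with
  | _ N ih =>
  by_cases hi : Indecomposable X
  · exact ⟨X, isDirectSummand_refl X, hi, h⟩
  have h0 : ¬ IsZero X := fun h0 => h (contractible_of_isZero h0)
  rw [Indecomposable, not_and] at hi
  have h1 := hi h0
  push Not at h1
  obtain ⟨Y, Z, e, hY, hZ⟩ := h1
  -- Summands of `X` vanish outside the same range of degrees, so one rank function, with `a` and
  -- `b` fixed, serves throughout the induction.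
  have key : ∀ {W : ChainComplex (Rep.{u} R (G × H)) ℤ}, IsDirectSummand W X →
      ∀ n, n < a ∨ b < n → IsZero (W.X n) := fun {W} hW n hn => by
    obtain ⟨r⟩ := (hW.eval n).nonempty_retract
    rw [IsZero.iff_id_eq_zero, ← r.retract, (hab n hn).eq_of_tgt r.i 0, zero_comp]
  have hYX := IsDirectSummand.left e
  have hZX := IsDirectSummand.right e
  have hY1 := hX.of_isDirectSummand hYX
  have hZ1 := hX.of_isDirectSummand hZX
  have hr := complexRank_eq_add a b hX e
  have hY2 := complexRank_pos hY1 (key hYX) hY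
  have hZ2 := complexRank_pos hZ1 (key hZX) hZ
  -- `Y` and `Z` are not both contractible, and each has smaller rank than `X` because the other one
  -- has positive rank.
  by_cases hc : Contractible Y
  · have hc' : ¬ Contractible Z := fun hc' => h (.of_biprod_iso e hc hc')
    obtain ⟨D, hD, hD'⟩ := ih _ (by lia) hZ1 hc' (key hZX) rfl
    exact ⟨D, hD.trans hZX, hD'⟩
  · obtain ⟨D, hD, hD'⟩ := ih _ (by lia) hY1 hc (key hYX) rfl
    exact ⟨D, hD.trans hYX, hD'⟩

end Rank

/-! ### Splendidness and uniqueness of the summand -/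

section Main

open IsLocalRing

variable {p : ℕ} [Fact p.Prime] {R : Type u} [CommRing R] [IsDomain R] [IsLocalRing R]
  [IsNoetherianRing R] [IsAdicComplete (maximalIdeal R) R] [CharP (ResidueField R) p]
  {G H : Type u} [Group G] [Group H] {A : BlockSum R G} {B : BlockSum R H}
  {C D Z : ChainComplex (Rep.{u} R (G × H)) ℤ}

/-- A splendid Rickard complex stays splendid when a contractible summand is removed. -/
lemma IsSplendidRickardComplex.of_iso_biprod (hC : IsSplendidRickardComplex p A B C)
    (e : C ≅ D ⊞ Z) (hZ : Contractible Z) : IsSplendidRickardComplex p A B D := by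
  have hDC : IsDirectSummand D C := .left e
  have hD := hC.bimoduleComplex.of_isDirectSummand hDC
  obtain ⟨h⟩ := hZ
  obtain ⟨t⟩ := hC.tensor_dual
  obtain ⟨t'⟩ := hC.dual_tensor
  have f : HomotopyEquiv D C := (homotopyEquivOfContractible e h).symm
  refine ⟨hD, fun n P hP => ?_, fun n M hM => hC.vertex n M (hM.trans (hDC.eval n)),
    ⟨(tensorHomotopyEquiv f (dualHomotopyEquiv f)).trans t⟩,
    ⟨(tensorHomotopyEquiv (dualHomotopyEquiv f) f).trans t'⟩⟩
  -- The restriction of `D.X n` to a `p`-subgroup is a finitely generated summand of a permutation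
  -- module, hence itself a permutation module.
  have hfin : Module.Finite R (Rep.res P.subtype (D.X n)) := (hD.bimodule n).finite
  exact (hC.pPermutation n P hP).of_isDirectSummand hP
    ((hDC.eval n).map (Rep.resFunctor P.subtype))

/-- The complement of `D` is contractible, so `D ≃ C`. A competing summand has local endomorphism
ring, hence is a summand of `D` or of that complement; the second would make it contractible, and
the first makes it isomorphic to `D`. -/
lemma IsSplendidRickardComplex.exists_unique_summand (hC : IsSplendidRickardComplex p A B C)
    (hB : B.IsBlock) :
    ∃ D : ChainComplex (Rep.{u} R (G × H)) ℤ,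
      IsDirectSummand D C ∧ Indecomposable D ∧ ¬ Contractible D ∧
      IsSplendidRickardComplex p A B D ∧
      ∀ D' : ChainComplex (Rep.{u} R (G × H)) ℤ,
        IsDirectSummand D' C → Indecomposable D' → ¬ Contractible D' → Nonempty (D' ≅ D) := by
  obtain ⟨D, hDC, hD, hD'⟩ := hC.bimoduleComplex.exists_indecomposable_summand
    (hC.not_contractible hB)
  obtain ⟨Z, ⟨e⟩⟩ := id hDC
  have hZ := hC.contractible_of_iso_biprod hB e hD'
  refine ⟨D, hDC, hD, hD', hC.of_iso_biprod e hZ, fun E hEC hE hE' => ?_⟩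
  have := (hC.bimoduleComplex.of_isDirectSummand hEC).finite_end
  have := isLocalRing_end_of_indecomposable (R := R) hE
  obtain h | h := (hEC.trans (.of_retract (Retract.ofIso e))).left_or_right
  · obtain ⟨r⟩ := h.nonempty_retract
    exact nonempty_iso_of_retract_indecomposable r hE.1 hD
  · obtain ⟨r⟩ := h.nonempty_retract
    exact (hE' (hZ.of_retract r)).elim

end Main

end Splendid
end

theorem proposition5p3 {p : ℕ} [Fact p.Prime] {R : Type u} [CommRing R] [IsDomain R]
    [IsLocalRing R] [IsAlgClosed (IsLocalRing.ResidueField R)]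
    [CharP (IsLocalRing.ResidueField R) p]
    (hR : IsField R ∨
      IsDiscreteValuationRing R ∧ CharZero R ∧ IsAdicComplete (IsLocalRing.maximalIdeal R) R)
    {G H : Type u} [Group G] [Finite G] [Group H] [Finite H]
    (A : Splendid.BlockSum R G) (hA : A.IsBlock) (B : Splendid.BlockSum R H) (hB : B.IsBlock)
    (C : ChainComplex (Rep.{u} R (G × H)) ℤ) (hC : Splendid.IsSplendidRickardComplex p A B C) :
    Indecomposable (Splendid.toHomotopyCategory C hC.bimoduleComplex) ∧
    ∃ D : ChainComplex (Rep.{u} R (G × H)) ℤ,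
      Splendid.IsDirectSummand D C ∧ Indecomposable D ∧ ¬ Splendid.Contractible D ∧
      Splendid.IsSplendidRickardComplex p A B D ∧
      ∀ D' : ChainComplex (Rep.{u} R (G × H)) ℤ,
        Splendid.IsDirectSummand D' C → Indecomposable D' → ¬ Splendid.Contractible D' →
          Nonempty (D' ≅ D) := by
  refine ⟨hC.indecomposable_toHomotopyCategory hB, ?_⟩
  obtain ⟨_, _⟩ : IsNoetherianRing R ∧ IsAdicComplete (IsLocalRing.maximalIdeal R) R := by
    obtain h | ⟨_, -, h⟩ := hR
    · let _ := h.toField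
      have hm : IsLocalRing.maximalIdeal R = ⊥ := IsLocalRing.isField_iff_maximalIdeal_eq.1 h
      rw [hm]
      exact ⟨inferInstance, inferInstance⟩
    · exact ⟨inferInstance, h⟩
  exact hC.exists_unique_summand hB
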